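/- Let $X$ be a finite multiset of nonzero vectors of $\mathbb R^n$ that spans $\mathbb R^n$. Sub-multisets $Y\subset X$ are counted with multiplicity, i.e. they are sets of indices for an enumeration of $X$. Let $\Pi=\mathbb C[t_1,\dots,t_n]$. For $y\in\mathbb R^n$ put $p_y(t)=y\cdot t$, and for $Y\subset X$ put $p_Y=\prod_{y\in Y}p_y$. For $p\in\Pi$ let $p(D)=p(\partial/\partial t_1,\dots,\partial/\partial t_n)$, and for $p\in\Pi$ and a formal power series $f$ let $\langle p,f\rangle=(p(D)f)(0)$. Let $\mathbb B(X)$ be the set of all $B\subset X$ that are bases of $\mathbb R^n$; let $L(X)$ be the set of all $Y\subset X$ that meet every $B\in\mathbb B(X)$, and $S(X)$ the set of all $Y\subset X$ such that $X\setminus Y$ has rank $n$. Put $$\mathcal P(X)=\operatorname{span}\{p_Y: Y\in S(X)\},\qquad \mathcal D(X)=\{f\in\Pi: p_Y(D)f=0\ \ \forall\, Y\in L(X)\},$$ and let $\mathcal J(X)\subset\Pi$ be the ideal generated by $\{p_Y: Y\in L(X)\}$. Let $\mathcal F(X)$ be the set of subspaces $H\subset\mathbb R^n$ of dimension $n-1$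 that are spanned by $X\cap H$; for $H\in\mathcal F(X)$ let $\eta_H$ be a nonzero normal to $H$ and $m(H)=\#(X\setminus H)$. Let $\mathcal I(X)\subset\Pi$ be the ideal generated by $\{p_{\eta_H}^{\,m(H)}:H\in\mathcal F(X)\}$. For an ideal $I\subset \Pi$ let $\ker I$ be the span of all $e_\alpha p$, where $\alpha\in\mathbb C^n$ is a common zero of $I$, $e_\alpha(t)=e^{\alpha\cdot t}$, $p\in\Pi$, and $\langle q,e_\alpha p\rangle=0$ for all $q\in I$. For $\lambda\in\mathbb R^X$ let $H_{x,\lambda}=\{t\in\mathbb R^n: x\cdot t=\lambda_x\}$ $(x\in X)$. Call $\lambda$ generic if any $n+1$ of these hyperplanes (indexed by the elements of the multiset $X$) have empty intersection, and let $V(X,\lambda)$ be the set of vertices of the arrangement, i.e. the points that are the intersection of some of the hyperplanes. For finite $\sigma\subset\mathbb R^n$ let $\Pi(\sigma)$ be the span of all $f_\downarrow$ with $f\in\operatorname{span}\{e_\alpha:\alpha\in\sigma\}$, where $f_\downarrow$ is the nonzero homogeneous component of lowest degree in the power series of $f$ at $0$ (and $0_\downarrow=0$). The set $\sigma$ is correct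 for a subspace $F\subset\Pi$ if the restriction $F\to\mathbb C^\sigma$, $p\mapsto p|_\sigma$, is bijective. Then, for every generic $\lambda$ in (3) and (4): 1. $\dim\mathcal P(X)=\dim\mathcal D(X)=\#\mathbb B(X)$. 2. The map $p\mapsto\langle p,\cdot\rangle$ is a bijection from $\mathcal D(X)$ onto the dual space $\mathcal P(X)'$. 3. $\mathcal D(X)=\Pi(V(X,\lambda))=\ker\mathcal J(X)$, and $\ker\mathcal J(X)=\{p\in\Pi: q(D)p=0\ \forall\, q\in\mathcal J(X)\}$. 4. $V(X,\lambda)$ is correct for $\mathcal D(X)$ and for $\mathcal P(X)$. 5. $\mathcal P(X)=\ker\mathcal I(X)$, and $\ker\mathcal I(X)=\{p\in\Pi: q(D)p=0\ \forall\, q\in\mathcal I(X)\}$. 6. $\Pi=\mathcal P(X)\oplus\mathcal J(X)$. -/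

import Mathlib

namespace Zonotopal

noncomputable section

/-! ## Differential operators, the pairing, the least map -/

/-- The ring of complex polynomials in `n` variables. -/
abbrev Poly (n : ℕ) : Type := MvPolynomial (Fin n) ℂ

/-- The space of formal power series in `n` variables over `ℂ`. -/
abbrev Series (n : ℕ) : Type := MvPowerSeries (Fin n) ℂ

variable {n : ℕ}

/-- The inclusion of polynomials into formal power series. -/
def toSeries : Poly n →ₗ[ℂ] Series n where
  toFun p := (p : Series n)
  map_add' p q := MvPolynomial.coe_add p q
  map_smul' c p := MvPolynomial.coe_smul p c

/-- Substitution of endomorphisms `d 0, …, d (n-1)` for the variables of a polynomial: the linear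
map that sends each monomial `t ^ a` to `d 0 ^ a 0 * ⋯ * d (n-1) ^ a (n-1)`. It is used below only
for the (commuting) partial derivatives. -/
def substOp {M : Type*} [AddCommGroup M] [Module ℂ M] (d : Fin n → Module.End ℂ M) :
    Poly n →ₗ[ℂ] Module.End ℂ M :=
  (MvPolynomial.basisMonomials (Fin n) ℂ).constr ℂ
    (fun a : Fin n →₀ ℕ => (List.ofFn fun i => d i ^ a i).prod)

/-- The differential operator `p(D) = p(∂/∂t₁, …, ∂/∂tₙ)` on polynomials. -/
def diffOp : Poly n →ₗ[ℂ] Module.End ℂ (Poly n) :=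
  substOp fun i => (MvPolynomial.pderiv i : Derivation ℂ (Poly n) (Poly n)).toLinearMap

/-- The differential operator `p(D)` on formal power series. -/
def diffOpSeries : Poly n →ₗ[ℂ] Module.End ℂ (Series n) :=
  substOp fun i => (MvPowerSeries.pderiv ℂ i : Derivation ℂ (Series n) (Series n)).toLinearMap

/-- The pairing `⟨p, f⟩ = (p(D) f)(0)` of a polynomial with a formal power series. -/
def pairing : Poly n →ₗ[ℂ] Series n →ₗ[ℂ] ℂ :=
  diffOpSeries.compr₂ (MvPowerSeries.coeff (0 : Fin n →₀ ℕ))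

/-- The (Taylor series at the origin of the) exponential `t ↦ exp (α ⬝ t)`. -/
def expSeries (α : Fin n → ℂ) : Series n :=
  fun a => ∏ i, α i ^ a i / (Nat.factorial (a i) : ℂ)

/-- The least term of a power series: its nonzero homogeneous component of lowest degree, and `0`
for the zero series. -/
def least (f : Series n) : Poly n :=
  ∑ a ∈ Finset.finsuppAntidiag (Finset.univ : Finset (Fin n)) f.order.toNat,
    MvPolynomial.monomial a (MvPowerSeries.coeff a f)

theorem coe_least (f : Series n) :
    (least f : Series n) = MvPowerSeries.homogeneousComponent f.order.toNat f := by
  ext a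
  rw [MvPolynomial.coeff_coe, MvPowerSeries.coeff_homogeneousComponent, least,
    MvPolynomial.coeff_sum]
  simp only [MvPolynomial.coeff_monomial, Finset.sum_ite_eq', Finset.mem_finsuppAntidiag,
    Finset.subset_univ, and_true, Finsupp.degree_eq_sum]

/-- `Exp(σ)`: the span of the exponentials with frequencies in `σ`. -/
def Exp (σ : Set (Fin n → ℂ)) : Submodule ℂ (Series n) :=
  Submodule.span ℂ (expSeries '' σ)

/-- `Π(σ)`: the span of the least terms of the elements of `Exp(σ)`. -/
def leastSpace (σ : Set (Fin n → ℂ)) : Submodule ℂ (Poly n) :=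
  Submodule.span ℂ (least '' (Exp σ : Set (Series n)))

/-- `σ` is correct for `P`: restriction to `σ` is a bijection from `P` onto `ℂ^σ`. -/
def Correct (σ : Set (Fin n → ℂ)) (P : Submodule ℂ (Poly n)) : Prop :=
  Function.Bijective fun (p : P) (v : σ) => MvPolynomial.eval (v : Fin n → ℂ) (p : Poly n)

/-! ## Kernels of polynomial ideals -/

/-- The kernel of an ideal `I`: the span of all exponential polynomials `e_α p`, with `α` in the
variety of `I` and `p` a polynomial, that are orthogonal to `I`. -/
def ker (I : Ideal (Poly n)) : Submodule ℂ (Series n) :=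
  Submodule.span ℂ {g | ∃ α ∈ MvPolynomial.zeroLocus ℂ I, ∃ p : Poly n,
    g = expSeries α * (p : Series n) ∧ ∀ q ∈ I, pairing q g = 0}

/-- The polynomial kernel of an ideal: the polynomials annihilated by `q(D)` for all `q ∈ I`. -/
def polyKer (I : Ideal (Poly n)) : Submodule ℂ (Poly n) :=
  ⨅ q ∈ I, LinearMap.ker (diffOp q)

/-! ## The matroid of `X` and its hyperplane arrangement

A finite multiset of vectors of `ℝⁿ` is given as a family `X : ι → ℝⁿ` with `ι` finite; its
sub-multisets are the finite sets of indices. -/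

variable {ι : Type*}

/-- `𝔹(X)`: the bases of `ℝⁿ` selected from `X`. -/
def bases (X : ι → Fin n → ℝ) : Set (Finset ι) :=
  {B | LinearIndependent ℝ (fun b : B => X b) ∧ Submodule.span ℝ (X '' B) = ⊤}

/-- `L(X)`: the long subsets, those that meet every basis. -/
def long (X : ι → Fin n → ℝ) : Set (Finset ι) :=
  {Y | ∀ B ∈ bases X, ∃ i ∈ Y, i ∈ B}

/-- `S(X)`: the short subsets, those whose complement has full rank. -/
def short (X : ι → Fin n → ℝ) : Set (Finset ι) :=
  {Y | Set.finrank ℝ (X '' {i | i ∉ Y}) = n}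

/-- The hyperplane `H_{x,λ} = {t | x ⬝ t = λ_x}` attached to the element of `X` with index `i`. -/
def hyperplane (X : ι → Fin n → ℝ) (lam : ι → ℝ) (i : ι) : Set (Fin n → ℝ) :=
  {t | X i ⬝ᵥ t = lam i}

/-- `λ` is generic: any `n + 1` of the hyperplanes have empty intersection. -/
def Generic (X : ι → Fin n → ℝ) (lam : ι → ℝ) : Prop :=
  ∀ s : Finset ι, s.card = n + 1 → ⋂ i ∈ s, hyperplane X lam i = ∅

/-- `V(X, λ)`: the vertices of the arrangement, i.e. the points that are the intersection of some
of the hyperplanes. -/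
def vertices (X : ι → Fin n → ℝ) (lam : ι → ℝ) : Set (Fin n → ℝ) :=
  {v | ∃ s : Finset ι, ⋂ i ∈ s, hyperplane X lam i = {v}}

/-- A set of real points, regarded as a set of complex points. -/
def complexify (σ : Set (Fin n → ℝ)) : Set (Fin n → ℂ) :=
  (fun v i => (v i : ℂ)) '' σ

/-- `ℱ(X)`: the hyperplanes (through the origin) that are spanned by elements of `X`. -/
def facets (X : ι → Fin n → ℝ) : Set (Submodule ℝ (Fin n → ℝ)) :=
  {H | Module.finrank ℝ H + 1 = n ∧ Submodule.span ℝ (Set.range X ∩ H) = H}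

/-- `m(H)`: the number of elements of `X`, with multiplicity, outside `H`. -/
def mult (X : ι → Fin n → ℝ) (H : Submodule ℝ (Fin n → ℝ)) : ℕ :=
  Set.ncard {i | X i ∉ H}

/-! ## The central spaces and ideals -/

/-- The linear form `p_x : t ↦ x ⬝ t`. -/
def linForm (x : Fin n → ℝ) : Poly n :=
  ∑ i, MvPolynomial.C (x i : ℂ) * MvPolynomial.X i

/-- `p_Y`, the product of the linear forms of the elements of `Y`. -/
def prodForm (X : ι → Fin n → ℝ) (Y : Finset ι) : Poly n :=
  ∏ i ∈ Y, linForm (X i)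

/-- `𝒫(X)`, spanned by the `p_Y` with `Y` short. -/
def P (X : ι → Fin n → ℝ) : Submodule ℂ (Poly n) :=
  Submodule.span ℂ (prodForm X '' short X)

/-- `𝒟(X)`, the polynomials annihilated by `p_Y(D)` for all long `Y`. -/
def D (X : ι → Fin n → ℝ) : Submodule ℂ (Poly n) :=
  ⨅ Y ∈ long X, LinearMap.ker (diffOp (prodForm X Y))

/-- `𝒥(X)`, the ideal generated by the `p_Y` with `Y` long. -/
def J (X : ι → Fin n → ℝ) : Ideal (Poly n) :=
  Ideal.span (prodForm X '' long X)

/-- `ℐ(X)`, the ideal generated by the powers `p_η ^ m(H)`, with `H` a facet hyperplane and `η` a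
nonzero normal to `H`. As `η` is unique up to a nonzero factor, admitting all normals generates
the same ideal as choosing one. -/
def I (X : ι → Fin n → ℝ) : Ideal (Poly n) :=
  Ideal.span {p | ∃ H ∈ facets X, ∃ η : Fin n → ℝ,
    η ≠ 0 ∧ (∀ h ∈ H, η ⬝ᵥ h = 0) ∧ p = linForm η ^ mult X H}

/-- The map `p ↦ ⟨p, ·⟩` from a polynomial space `F` to the dual of a polynomial space `G`. -/
def dualityMap (F G : Submodule ℂ (Poly n)) : F →ₗ[ℂ] Module.Dual ℂ G :=
  (pairing.compl₂ (toSeries ∘ₗ G.subtype)) ∘ₗ F.subtype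

end

end Zonotopal

namespace Zonotopal

variable {n : ℕ}

/-! ## Constant-coefficient differential operators and the pairing -/

/-! Every dimension is squeezed between a spanning set indexed by the bases and interpolation at the
vertices of a generic arrangement.

The upper bound is a deletion–contraction induction, `exists_short_family`. It works relative to an
independent set `A` of contracted elements and a set `S` of remaining ones, and reads polynomials
modulo those vanishing on `A^⊥`. To split off `x ∈ S`, decompose `f` on `A^⊥ ∩ x^⊥` (contraction).
The error there is `p_x r` on `A^⊥`, and `r` is decomposed with `x` deleted. This attaches one short
product to each basis. These products, together with the long ideal, generate everything. The same
induction shows that they span the polynomials of small degree along all facet normals, because that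
condition survives restriction to `x^⊥` and division by `p_x`. For `A = ∅` this gives `P_structure`:
`P X = polyKer (I X)`, `P X + J X` is everything, and `dim P X` is at most the number of bases.

For the lower bounds, a generic arrangement has exactly one vertex per basis. Shifted products,
which lie in `P X`, are Lagrange polynomials there (`Generic.exists_lagrange`). The least space of
the vertices lies in `D X` (`Generic.leastSpace_le_D`), and a positivity argument shows that it
interpolates as well (`Generic.evalMap_leastSpace_surjective`).

Since `D X = polyKer (J X)` is orthogonal to `J X`, the relation `P X + J X = ⊤` embeds `D X` in the
dual of `P X`. All inequalities then close up: `D X` is the least space, the pairing is perfect, and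
`P X` meets `J X` in zero. Both ideals vanish only at the origin, so their kernels contain no
genuine exponentials. -/

open scoped IsMulCommutative in
theorem substOp_eq_aeval {M : Type*} [AddCommGroup M] [Module ℂ M] (d : Fin n → Module.End ℂ M)
    (hd : ∀ i j, d i * d j = d j * d i) :
    ∃ φ : Poly n →ₐ[ℂ] Module.End ℂ M, (∀ p, φ p = substOp d p) ∧ ∀ i, φ (MvPolynomial.X i) = d i := by
  -- Commuting endomorphisms generate a commutative subalgebra; evaluating polynomials inside it
  -- shows that `substOp` is multiplicative.
  have hc : IsMulCommutative (Algebra.adjoin ℂ (Set.range d)) := Algebra.isMulCommutative_adjoin ℂ (by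
    rintro _ ⟨i, rfl⟩ _ ⟨j, rfl⟩
    exact hd i j)
  let e : Fin n → Algebra.adjoin ℂ (Set.range d) :=
    fun i => ⟨d i, Algebra.subset_adjoin (Set.mem_range_self i)⟩
  let φ : Poly n →ₐ[ℂ] Module.End ℂ M :=
    (Subalgebra.val (Algebra.adjoin ℂ (Set.range d))).comp (MvPolynomial.aeval e)
  refine ⟨φ, fun p => ?_, fun i => by simp [φ, e]⟩
  have h : φ.toLinearMap = substOp d := by
    refine (MvPolynomial.basisMonomials (Fin n) ℂ).ext fun a => ?_
    rw [substOp, Module.Basis.constr_basis, MvPolynomial.coe_basisMonomials]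
    have h1 : MvPolynomial.aeval e (MvPolynomial.monomial a (1 : ℂ)) =
        (List.ofFn fun i => e i ^ a i).prod := by
      rw [MvPolynomial.aeval_monomial, map_one, one_mul, List.prod_ofFn,
        Finsupp.prod_fintype _ _ (fun i => pow_zero _)]
    change (Subalgebra.val _) (MvPolynomial.aeval e (MvPolynomial.monomial a (1 : ℂ))) = _
    rw [h1, map_list_prod, List.map_ofFn]
    rfl
  exact LinearMap.congr_fun h p

theorem pderiv_mul_comm (i j : Fin n) :
    ((MvPolynomial.pderiv i : Derivation ℂ (Poly n) (Poly n)).toLinearMap : Module.End ℂ (Poly n)) *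
        (MvPolynomial.pderiv j : Derivation ℂ (Poly n) (Poly n)).toLinearMap =
      ((MvPolynomial.pderiv j : Derivation ℂ (Poly n) (Poly n)).toLinearMap :
          Module.End ℂ (Poly n)) *
        (MvPolynomial.pderiv i : Derivation ℂ (Poly n) (Poly n)).toLinearMap := by
  refine LinearMap.ext fun f => MvPolynomial.ext _ _ fun a => ?_
  simp only [Module.End.mul_apply, Derivation.coeFn_coe,
    MvPolynomial.coeff_pderiv, Finsupp.add_apply, Finsupp.single_apply]
  rw [add_right_comm]
  by_cases h : i = j
  · subst h; rfl
  · simp [h, Ne.symm h]; ring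

theorem pderivSeries_mul_comm (i j : Fin n) :
    ((MvPowerSeries.pderiv ℂ i : Derivation ℂ (Series n) (Series n)).toLinearMap :
        Module.End ℂ (Series n)) *
        (MvPowerSeries.pderiv ℂ j : Derivation ℂ (Series n) (Series n)).toLinearMap =
      ((MvPowerSeries.pderiv ℂ j : Derivation ℂ (Series n) (Series n)).toLinearMap :
          Module.End ℂ (Series n)) *
        (MvPowerSeries.pderiv ℂ i : Derivation ℂ (Series n) (Series n)).toLinearMap := by
  ext1 f
  ext a
  simp only [Module.End.mul_apply, Derivation.coeFn_coe,
    MvPowerSeries.coeff_pderiv, Finsupp.add_apply, Finsupp.single_apply]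
  rw [add_right_comm]
  by_cases h : i = j
  · subst h; rfl
  · simp [h, Ne.symm h]; ring

theorem diffOp_mul (p q : Poly n) : diffOp (p * q) = diffOp p * diffOp q := by
  obtain ⟨φ, h, -⟩ := substOp_eq_aeval _ (pderiv_mul_comm (n := n))
  simp only [diffOp, ← h, map_mul]

theorem diffOp_X (i : Fin n) (f : Poly n) :
    diffOp (MvPolynomial.X i) f = MvPolynomial.pderiv i f := by
  obtain ⟨φ, h, h'⟩ := substOp_eq_aeval _ (pderiv_mul_comm (n := n))
  rw [diffOp, ← h, h']; rfl

theorem diffOp_C (c : ℂ) (f : Poly n) : diffOp (MvPolynomial.C c) f = c • f := by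
  obtain ⟨φ, h, -⟩ := substOp_eq_aeval _ (pderiv_mul_comm (n := n))
  rw [diffOp, ← h, ← MvPolynomial.algebraMap_eq, AlgHom.commutes]; rfl

theorem diffOpSeries_mul (p q : Poly n) :
    diffOpSeries (p * q) = diffOpSeries p * diffOpSeries q := by
  obtain ⟨φ, h, -⟩ := substOp_eq_aeval _ (pderivSeries_mul_comm (n := n))
  simp only [diffOpSeries, ← h, map_mul]

theorem diffOpSeries_X (i : Fin n) (f : Series n) :
    diffOpSeries (MvPolynomial.X i) f = MvPowerSeries.pderiv ℂ i f := by
  obtain ⟨φ, h, h'⟩ := substOp_eq_aeval _ (pderivSeries_mul_comm (n := n))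
  rw [diffOpSeries, ← h, h']; rfl

theorem diffOpSeries_C (c : ℂ) (f : Series n) : diffOpSeries (MvPolynomial.C c) f = c • f := by
  obtain ⟨φ, h, -⟩ := substOp_eq_aeval _ (pderivSeries_mul_comm (n := n))
  rw [diffOpSeries, ← h, ← MvPolynomial.algebraMap_eq, AlgHom.commutes]; rfl

theorem toSeries_injective : Function.Injective (toSeries (n := n)) :=
  MvPolynomial.coe_injective _ _

theorem coeff_toSeries (p : Poly n) (a : Fin n →₀ ℕ) :
    MvPowerSeries.coeff a (toSeries p) = MvPolynomial.coeff a p :=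
  MvPolynomial.coeff_coe p a

theorem diffOpSeries_toSeries (p f : Poly n) :
    diffOpSeries p (toSeries f) = toSeries (diffOp p f) := by
  induction p using MvPolynomial.induction_on generalizing f with
  | C c => rw [diffOp_C, diffOpSeries_C, map_smul]
  | add p q hp hq => rw [map_add, map_add, LinearMap.add_apply, LinearMap.add_apply, hp, hq, map_add]
  | mul_X p i hp =>
    rw [diffOpSeries_mul, diffOp_mul, Module.End.mul_apply, Module.End.mul_apply, diffOp_X,
      diffOpSeries_X, ← hp]
    congr 1
    exact MvPowerSeries.pderiv_coe f

theorem pairing_mul (p q : Poly n) (f : Series n) :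
    pairing (p * q) f = pairing p (diffOpSeries q f) := by
  simp [pairing, LinearMap.compr₂_apply, diffOpSeries_mul]

theorem pairing_mul_toSeries (p q f : Poly n) :
    pairing (p * q) (toSeries f) = pairing p (toSeries (diffOp q f)) := by
  rw [pairing_mul, diffOpSeries_toSeries]

/-- The product of the factorials of the entries of a multi-index. -/
def multiFactorial (a : Fin n →₀ ℕ) : ℕ := ∏ i, (a i).factorial

theorem multiFactorial_ne_zero (a : Fin n →₀ ℕ) : (multiFactorial a : ℂ) ≠ 0 := by
  simp [multiFactorial, Finset.prod_eq_zero_iff, Nat.factorial_ne_zero]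

theorem multiFactorial_add_single (a : Fin n →₀ ℕ) (i : Fin n) :
    multiFactorial (a + Finsupp.single i 1) = multiFactorial a * (a i + 1) := by
  unfold multiFactorial
  rw [← Finset.mul_prod_erase _ _ (Finset.mem_univ i), ← Finset.mul_prod_erase Finset.univ
    (fun i => (a i).factorial) (Finset.mem_univ i)]
  have : ∏ x ∈ Finset.univ.erase i, ((a + Finsupp.single i 1 : Fin n →₀ ℕ) x).factorial =
      ∏ x ∈ Finset.univ.erase i, (a x).factorial := by
    refine Finset.prod_congr rfl fun x hx => ?_
    simp [(Finset.ne_of_mem_erase hx).symm]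
  rw [this]
  simp [Nat.factorial_succ]
  ring

theorem pairing_monomial (a : Fin n →₀ ℕ) (c : ℂ) (f : Series n) :
    pairing (MvPolynomial.monomial a c) f = c * multiFactorial a * MvPowerSeries.coeff a f := by
  induction hk : a.degree generalizing a f with
  | zero =>
    rw [Finsupp.degree_eq_zero_iff] at hk
    subst hk
    rw [← MvPolynomial.C_apply, pairing, LinearMap.compr₂_apply, diffOpSeries_C]
    simp [multiFactorial]
  | succ k ih =>
    obtain ⟨i, hi⟩ : ∃ i, a i ≠ 0 := by
      by_contra! h
      have : a = 0 := Finsupp.ext h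
      simp [this] at hk
    obtain ⟨b, rfl⟩ : ∃ b, a = b + Finsupp.single i 1 :=
      ⟨a - Finsupp.single i 1, (tsub_add_cancel_of_le (by
        rw [Finsupp.single_le_iff]; lia)).symm⟩
    have hb : b.degree = k := by simpa using hk
    have hm : MvPolynomial.monomial (b + Finsupp.single i 1) c =
        MvPolynomial.monomial b c * MvPolynomial.X i := by
      rw [MvPolynomial.X, MvPolynomial.monomial_mul, mul_one]
    rw [hm, pairing_mul, ih b _ hb, diffOpSeries_X, MvPowerSeries.coeff_pderiv,
      multiFactorial_add_single]
    push_cast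
    ring

theorem pairing_eq_sum (p : Poly n) (f : Series n) :
    pairing p f = ∑ a ∈ p.support,
      MvPolynomial.coeff a p * multiFactorial a * MvPowerSeries.coeff a f := by
  conv_lhs => rw [p.as_sum, map_sum, LinearMap.sum_apply]
  simp only [pairing_monomial]

theorem pairing_comm (p q : Poly n) : pairing p (toSeries q) = pairing q (toSeries p) := by
  induction p using MvPolynomial.induction_on' with
  | add p₁ p₂ h₁ h₂ => simp only [map_add, LinearMap.add_apply, h₁, h₂]
  | monomial a c =>
    classical
    rw [pairing_monomial, pairing_eq_sum, coeff_toSeries]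
    simp only [coeff_toSeries, MvPolynomial.coeff_monomial, mul_ite, mul_zero,
      Finset.sum_ite_eq, MvPolynomial.mem_support_iff, ite_not]
    split_ifs with h
    · simp [h]
    · ring

theorem eq_zero_of_pairing_eq_zero {f : Series n} (h : ∀ p, pairing p f = 0) : f = 0 := by
  ext a
  have := h (MvPolynomial.monomial a 1)
  rw [pairing_monomial] at this
  simpa only [one_mul, mul_eq_zero, multiFactorial_ne_zero, false_or, map_zero] using this

theorem pairing_expSeries (p : Poly n) (α : Fin n → ℂ) :
    pairing p (expSeries α) = MvPolynomial.eval α p := by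
  induction p using MvPolynomial.induction_on' with
  | add p₁ p₂ h₁ h₂ => simp only [map_add, LinearMap.add_apply, h₁, h₂]
  | monomial a c =>
    rw [pairing_monomial, MvPolynomial.eval_monomial, Finsupp.prod_fintype _ _ (fun i => pow_zero _),
      mul_assoc]
    congr 1
    change (multiFactorial a : ℂ) * ∏ i, α i ^ a i / (Nat.factorial (a i) : ℂ) = _
    rw [multiFactorial, Nat.cast_prod, ← Finset.prod_mul_distrib]
    refine Finset.prod_congr rfl fun i _ => ?_
    rw [mul_div_cancel₀]
    exact_mod_cast Nat.factorial_ne_zero _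

theorem expSeries_zero : expSeries (0 : Fin n → ℂ) = 1 := by
  classical
  ext a
  change ∏ i, (0 : ℂ) ^ a i / (Nat.factorial (a i) : ℂ) = _
  rw [MvPowerSeries.coeff_one]
  split_ifs with h
  · simp [h]
  · obtain ⟨i, hi⟩ : ∃ i, a i ≠ 0 := by
      by_contra! h'
      exact h (Finsupp.ext h')
    exact Finset.prod_eq_zero (Finset.mem_univ i) (by simp [hi])

/-! ## Kernels of ideals -/

theorem mem_polyKer {I : Ideal (Poly n)} {f : Poly n} :
    f ∈ polyKer I ↔ ∀ q ∈ I, diffOp q f = 0 := by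
  simp [polyKer]

theorem mem_polyKer_span {S : Set (Poly n)} {f : Poly n} :
    f ∈ polyKer (Ideal.span S) ↔ ∀ q ∈ S, diffOp q f = 0 := by
  rw [mem_polyKer]
  refine ⟨fun h q hq => h q (Ideal.subset_span hq), fun h q hq => ?_⟩
  induction hq using Submodule.span_induction with
  | mem x hx => exact h x hx
  | zero => simp
  | add x y _ _ hx hy => simp [hx, hy]
  | smul a x _ hx => simp [diffOp_mul, hx]

/-- Orthogonality looks only at the value of `q(D) f` at the origin, but an ideal also contains all
`p * q`, and these detect every derivative of `q(D) f` there. -/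
theorem mem_polyKer_iff_pairing {I : Ideal (Poly n)} {f : Poly n} :
    f ∈ polyKer I ↔ ∀ q ∈ I, pairing q (toSeries f) = 0 := by
  rw [mem_polyKer]
  constructor
  · intro h q hq
    have := pairing_mul_toSeries 1 q f
    rwa [one_mul, h q hq, map_zero, map_zero] at this
  · intro h q hq
    refine toSeries_injective ?_
    rw [map_zero]
    refine eq_zero_of_pairing_eq_zero fun p => ?_
    rw [← pairing_mul_toSeries]
    exact h _ (I.mul_mem_left p hq)

/-- If the origin is the only common zero of `I`, then the kernel of `I` is polynomial. -/
theorem map_toSeries_polyKer {I : Ideal (Poly n)} (hI : MvPolynomial.zeroLocus ℂ I = {0}) :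
    (polyKer I).map toSeries = ker I := by
  apply le_antisymm
  · rintro _ ⟨p, hp, rfl⟩
    refine Submodule.subset_span ⟨0, by simp [hI], p, ?_, ?_⟩
    · rw [expSeries_zero, one_mul]; rfl
    · exact mem_polyKer_iff_pairing.1 hp
  · refine Submodule.span_le.2 ?_
    rintro _ ⟨α, hα, p, rfl, h⟩
    rw [hI, Set.mem_singleton_iff] at hα
    subst hα
    rw [expSeries_zero, one_mul] at h ⊢
    exact ⟨p, mem_polyKer_iff_pairing.2 h, rfl⟩

/-! ## Restriction of polynomials to lines -/

/-- A real point regarded as a complex point. -/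
def toComplex (t : Fin n → ℝ) : Fin n → ℂ := fun k => (t k : ℂ)

@[simp]
theorem toComplex_apply (t : Fin n → ℝ) (k : Fin n) : toComplex t k = (t k : ℂ) := rfl

theorem complexify_eq (σ : Set (Fin n → ℝ)) : complexify σ = toComplex '' σ := rfl

theorem eval_linForm (x t : Fin n → ℝ) :
    MvPolynomial.eval (toComplex t) (linForm x) = ((x ⬝ᵥ t : ℝ) : ℂ) := by
  simp [linForm, dotProduct]

/-- Restriction of a polynomial to the line through `t` in the direction `η`. -/
noncomputable def lineHom (t η : Fin n → ℝ) : Poly n →ₐ[ℂ] Polynomial ℂ :=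
  MvPolynomial.aeval fun k => Polynomial.C (t k : ℂ) + Polynomial.C (η k : ℂ) * Polynomial.X

theorem lineHom_X (t η : Fin n → ℝ) (k : Fin n) : lineHom t η (MvPolynomial.X k) =
    Polynomial.C (t k : ℂ) + Polynomial.C (η k : ℂ) * Polynomial.X :=
  MvPolynomial.aeval_X _ _

theorem eval_lineHom (t η : Fin n → ℝ) (s : ℝ) (f : Poly n) :
    (lineHom t η f).eval (s : ℂ) = MvPolynomial.eval (toComplex (t + s • η)) f := by
  induction f using MvPolynomial.induction_on with
  | C c => simp [lineHom]
  | add p q hp hq => simp [hp, hq]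
  | mul_X p i hp =>
    rw [map_mul, Polynomial.eval_mul, hp, map_mul, lineHom_X]
    congr 1
    simp only [Polynomial.eval_add, Polynomial.eval_mul, Polynomial.eval_C, Polynomial.eval_X,
      MvPolynomial.eval_X, toComplex_apply, Pi.add_apply, Pi.smul_apply, smul_eq_mul, Complex.ofReal_add,
      Complex.ofReal_mul]
    ring

theorem lineHom_linForm (t η x : Fin n → ℝ) :
    lineHom t η (linForm x) =
      Polynomial.C ((x ⬝ᵥ t : ℝ) : ℂ) + Polynomial.C ((x ⬝ᵥ η : ℝ) : ℂ) * Polynomial.X := by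
  simp only [linForm, lineHom, dotProduct, map_sum, map_mul, MvPolynomial.aeval_X,
    Complex.ofReal_sum, Complex.ofReal_mul, mul_add, Finset.sum_add_distrib, Finset.sum_mul,
    ← mul_assoc, MvPolynomial.algHom_C, Polynomial.algebraMap_eq]

/-! ### Directional derivatives and degrees along lines. -/

theorem diffOp_one : diffOp (1 : Poly n) = 1 :=
  LinearMap.ext fun f => (diffOp_C 1 f).trans (one_smul _ f)

theorem diffOp_linForm (η : Fin n → ℝ) (f : Poly n) :
    diffOp (linForm η) f = ∑ i, (η i : ℂ) • MvPolynomial.pderiv i f := by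
  simp [linForm, diffOp_mul, diffOp_C, diffOp_X]

theorem derivative_lineHom (t η : Fin n → ℝ) (f : Poly n) :
    Polynomial.derivative (lineHom t η f) = lineHom t η (diffOp (linForm η) f) := by
  simp only [diffOp_linForm]
  induction f using MvPolynomial.induction_on with
  | C c => simp [lineHom]
  | add p q hp hq => simp [hp, hq, Finset.sum_add_distrib]
  | mul_X p i hp =>
    rw [map_mul, Polynomial.derivative_mul, hp]
    simp only [Derivation.leibniz, smul_add, Finset.sum_add_distrib, map_add, map_sum,
      MvPolynomial.pderiv_X, map_smul, smul_eq_mul, map_mul]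
    rw [add_comm]
    congr 1
    · rw [lineHom_X]
      rw [Finset.sum_eq_single i (fun j _ hj => by simp [hj.symm]) (by simp)]
      rw [Pi.single_eq_same, map_one, mul_one, Polynomial.smul_eq_C_mul, Polynomial.derivative_add,
        Polynomial.derivative_C, Polynomial.derivative_C_mul, Polynomial.derivative_X]
      ring
    · rw [Finset.sum_mul]
      exact Finset.sum_congr rfl fun j _ => by simp [mul_comm]

theorem iterate_derivative_lineHom (t η : Fin n → ℝ) (f : Poly n) (m : ℕ) :
    Polynomial.derivative^[m] (lineHom t η f) = lineHom t η (diffOp (linForm η ^ m) f) := by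
  induction m generalizing f with
  | zero => rw [pow_zero, diffOp_one]; rfl
  | succ m ih =>
    rw [Function.iterate_succ_apply, derivative_lineHom, ih, pow_succ, diffOp_mul,
      Module.End.mul_apply]

theorem iterate_derivative_eq_zero_iff (p : Polynomial ℂ) (m : ℕ) :
    Polynomial.derivative^[m] p = 0 ↔ p.degree < m := by
  refine ⟨fun h => ?_, Polynomial.iterate_derivative_eq_zero_of_degree_lt⟩
  rw [Polynomial.degree_lt_iff_coeff_zero]
  intro k hk
  obtain ⟨j, rfl⟩ := Nat.exists_eq_add_of_le' hk
  have := Polynomial.coeff_iterate_derivative p j (k := m)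
  rw [h, Polynomial.coeff_zero] at this
  simpa [Nat.descFactorial_eq_zero_iff_lt] using this.symm

/-- Translates the differential equations of `I X` into degree bounds on lines. The bounds make
sense for functions on `A^⊥` and behave well under multiplication by linear forms. -/
theorem degree_lineHom_lt_iff (t η : Fin n → ℝ) (f : Poly n) (m : ℕ) :
    (lineHom t η f).degree < m ↔ lineHom t η (diffOp (linForm η ^ m) f) = 0 := by
  rw [← iterate_derivative_eq_zero_iff, iterate_derivative_lineHom]

theorem polynomial_eq_zero_of_real {p : Polynomial ℂ} (h : ∀ s : ℝ, p.eval (s : ℂ) = 0) :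
    p = 0 := by
  refine Polynomial.eq_zero_of_infinite_isRoot p (Set.Infinite.mono ?_
    (Set.infinite_range_of_injective Complex.ofReal_injective))
  rintro _ ⟨s, rfl⟩
  exact h s

theorem diffOp_linForm_mul (η : Fin n → ℝ) (p f : Poly n) :
    diffOp (linForm η) (p * f) =
      p * diffOp (linForm η) f + f * diffOp (linForm η) p := by
  simp [diffOp_linForm, Finset.sum_add_distrib, Finset.mul_sum]

theorem diffOp_linForm_pow_mul {η x : Fin n → ℝ} (h : x ⬝ᵥ η = 0) (f : Poly n) (m : ℕ) :
    diffOp (linForm η ^ m) (linForm x * f) = linForm x * diffOp (linForm η ^ m) f := by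
  have h0 : diffOp (linForm η) (linForm x) = 0 := by
    have : diffOp (linForm η) (linForm x) = MvPolynomial.C ((x ⬝ᵥ η : ℝ) : ℂ) := by
      rw [diffOp_linForm]
      simp [linForm, dotProduct, Pi.single_apply, MvPolynomial.smul_eq_C_mul, mul_comm]
    rw [this, h]; simp
  induction m with
  | zero => rw [pow_zero, diffOp_one]; rfl
  | succ m ih =>
    rw [pow_succ', diffOp_mul, Module.End.mul_apply, ih, diffOp_linForm_mul, h0, mul_zero, add_zero,
      Module.End.mul_apply]

/-! ## Orthogonality -/

theorem exists_dotProduct_ne_zero {p : Submodule ℝ (Fin n → ℝ)} {v : Fin n → ℝ} (hv : v ∉ p) :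
    ∃ u, v ⬝ᵥ u ≠ 0 ∧ ∀ w ∈ p, w ⬝ᵥ u = 0 := by
  obtain ⟨f, hf, hp⟩ := Submodule.exists_le_ker_of_notMem hv
  have key : ∀ w, w ⬝ᵥ (dotProductEquiv ℝ (Fin n)).symm f = f w := fun w => by
    rw [dotProduct_comm]
    exact LinearMap.congr_fun ((dotProductEquiv ℝ (Fin n)).apply_symm_apply f) w
  exact ⟨_, by rwa [key], fun w hw => by rw [key]; exact hp hw⟩

theorem dotProduct_eq_zero_of_mem_span {s : Set (Fin n → ℝ)} {u v : Fin n → ℝ}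
    (h : ∀ w ∈ s, w ⬝ᵥ u = 0) (hv : v ∈ Submodule.span ℝ s) : v ⬝ᵥ u = 0 := by
  induction hv using Submodule.span_induction with
  | mem x hx => exact h x hx
  | zero => exact zero_dotProduct _
  | add x y _ _ hx hy => rw [add_dotProduct, hx, hy, add_zero]
  | smul a x _ hx => rw [smul_dotProduct, hx, smul_zero]

theorem span_eq_top_iff_dotProduct {s : Set (Fin n → ℝ)} :
    Submodule.span ℝ s = ⊤ ↔ ∀ u, (∀ w ∈ s, w ⬝ᵥ u = 0) → u = 0 := by
  constructor
  · intro h u hu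
    exact dotProduct_self_eq_zero.1 (dotProduct_eq_zero_of_mem_span hu (h ▸ Submodule.mem_top))
  · intro h
    by_contra hs
    obtain ⟨v, -, hv⟩ := SetLike.exists_of_lt (lt_top_iff_ne_top.2 hs)
    obtain ⟨u, hu, hu'⟩ := exists_dotProduct_ne_zero hv
    refine hu ?_
    rw [h u fun w hw => hu' w (Submodule.subset_span hw), dotProduct_zero]

/-! ## Polynomials vanishing on the orthogonal complement of a subfamily -/

variable {ι : Type*} (X : ι → Fin n → ℝ)

/-- The ideal of polynomials that vanish at the points orthogonal to `X i` for all `i ∈ A`. -/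
noncomputable def orthIdeal (A : Finset ι) : Ideal (Poly n) :=
  MvPolynomial.vanishingIdeal ℂ (complexify {t | ∀ i ∈ A, X i ⬝ᵥ t = 0})

variable {X}

theorem mem_orthIdeal {A : Finset ι} {f : Poly n} :
    f ∈ orthIdeal X A ↔
      ∀ t, (∀ i ∈ A, X i ⬝ᵥ t = 0) → MvPolynomial.eval (toComplex t) f = 0 := by
  simp [orthIdeal, complexify_eq, MvPolynomial.mem_vanishingIdeal_iff]

theorem orthIdeal_empty {f : Poly n} (h : f ∈ orthIdeal X ∅) : f = 0 := by
  refine MvPolynomial.funext_set (fun _ => Set.range Complex.ofReal)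
    (fun i => Set.infinite_range_of_injective Complex.ofReal_injective) fun x hx => ?_
  choose t ht using fun i => hx i (Set.mem_univ i)
  obtain rfl : toComplex t = x := funext ht
  rw [map_zero]
  exact mem_orthIdeal.1 h t (by simp)

theorem lineHom_eq_zero {A : Finset ι} {f : Poly n} (hf : f ∈ orthIdeal X A) {t η : Fin n → ℝ}
    (ht : ∀ i ∈ A, X i ⬝ᵥ t = 0) (hη : ∀ i ∈ A, X i ⬝ᵥ η = 0) : lineHom t η f = 0 := by
  refine polynomial_eq_zero_of_real fun s => ?_
  rw [eval_lineHom]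
  refine mem_orthIdeal.1 hf _ fun i hi => ?_
  rw [dotProduct_add, dotProduct_smul, ht i hi, hη i hi, smul_zero, add_zero]

theorem eval_eq_zero_of_lineHom {t η : Fin n → ℝ} {f : Poly n} (h : lineHom t η f = 0) :
    MvPolynomial.eval (toComplex t) f = 0 := by
  have := eval_lineHom t η 0 f
  rwa [h, Polynomial.eval_zero, zero_smul, add_zero, eq_comm] at this

/-- On a line of direction `u` inside `A^⊥`, the form `p_x` is a nonzero univariate polynomial and
can be cancelled. So `f` vanishes even at the points where `p_x` does. -/
theorem mem_orthIdeal_of_mul {A : Finset ι} {f : Poly n} {x u : Fin n → ℝ}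
    (hu : ∀ i ∈ A, X i ⬝ᵥ u = 0) (hxu : x ⬝ᵥ u ≠ 0) (hf : linForm x * f ∈ orthIdeal X A) :
    f ∈ orthIdeal X A := by
  refine mem_orthIdeal.2 fun t ht => eval_eq_zero_of_lineHom (η := u) ?_
  have h := lineHom_eq_zero hf ht hu
  rw [map_mul, mul_eq_zero, lineHom_linForm] at h
  refine h.resolve_left fun h' => hxu ?_
  simpa using congrArg (Polynomial.coeff · 1) h'

/-- A polynomial that vanishes on `A^⊥ ∩ x^⊥` is a multiple of `p_x` on `A^⊥`. -/
theorem exists_mul_sub_mem_orthIdeal [DecidableEq ι] {A : Finset ι} {x : ι} {f : Poly n}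
    {u : Fin n → ℝ}
    (hu : ∀ i ∈ A, X i ⬝ᵥ u = 0) (hxu : X x ⬝ᵥ u ≠ 0) (hf : f ∈ orthIdeal X (insert x A)) :
    ∃ h, f - linForm (X x) * h ∈ orthIdeal X A := by
  wlog h1 : X x ⬝ᵥ u = 1 generalizing u
  · refine this (u := (X x ⬝ᵥ u)⁻¹ • u) (fun i hi => ?_) ?_ ?_
    · rw [dotProduct_smul, hu i hi, smul_zero]
    · simp [hxu]
    · simp [hxu]
  -- Composition with the projection `t ↦ t - (x ⬝ t) u` onto `x^⊥`. It changes a polynomial by a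
  -- multiple of `p_x`, and it maps `A^⊥` into `A^⊥ ∩ x^⊥`, where `f` vanishes.
  let w : Poly n →ₐ[ℂ] Poly n :=
    MvPolynomial.aeval fun k => MvPolynomial.X k - MvPolynomial.C (u k : ℂ) * linForm (X x)
  have h2 : ∀ g : Poly n, g - w g ∈ Ideal.span {linForm (X x)} := fun g => by
    rw [← Ideal.Quotient.eq]
    induction g using MvPolynomial.induction_on with
    | C c => simp [w]
    | add p q hp hq => simp [hp, hq]
    | mul_X p i hp =>
      rw [map_mul, map_mul, map_mul, hp]
      congr 1
      rw [Ideal.Quotient.eq, Ideal.mem_span_singleton]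
      simp [w]
  obtain ⟨h, hh⟩ := Ideal.mem_span_singleton.1 (h2 f)
  refine ⟨h, ?_⟩
  rw [← hh, sub_sub_cancel]
  have h3 : ∀ (t : Fin n → ℝ) (g : Poly n), MvPolynomial.eval (toComplex t) (w g) =
      MvPolynomial.eval (toComplex (t - (X x ⬝ᵥ t) • u)) g := fun t g => by
    induction g using MvPolynomial.induction_on with
    | C c => simp [w]
    | add p q hp hq => simp [hp, hq]
    | mul_X p i hp =>
      rw [map_mul, map_mul, map_mul, hp]
      congr 1
      simp only [w, MvPolynomial.aeval_X, map_sub, map_mul, MvPolynomial.eval_X,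
        MvPolynomial.eval_C, eval_linForm, toComplex_apply, Pi.sub_apply, Pi.smul_apply, smul_eq_mul,
        Complex.ofReal_sub, Complex.ofReal_mul]
      ring
  refine mem_orthIdeal.2 fun t ht => ?_
  rw [h3]
  refine mem_orthIdeal.1 hf _ fun i hi => ?_
  rw [dotProduct_sub, dotProduct_smul]
  rcases Finset.mem_insert.1 hi with rfl | hi
  · simp [h1]
  · simp [hu i hi, ht i hi]

end Zonotopal

namespace Zonotopal

variable {n : ℕ} {ι : Type*}

/-! ## Relative versions of the central spaces -/

/-- The bases of `X` that contain `A` and are contained in `A ∪ S`. -/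
def basesBetween [DecidableEq ι] (X : ι → Fin n → ℝ) (A S : Finset ι) : Set (Finset ι) :=
  {B | B ∈ bases X ∧ A ⊆ B ∧ B ⊆ A ∪ S}

/-- The ideal generated by the `p_Y`, where `Y ⊆ S` meets every basis between `A` and `A ∪ S`. -/
noncomputable def longIdeal [DecidableEq ι] (X : ι → Fin n → ℝ) (A S : Finset ι) : Ideal (Poly n) :=
  Ideal.span (prodForm X '' {Y | Y ⊆ S ∧ ∀ B ∈ basesBetween X A S, ∃ i ∈ Y, i ∈ B})

/-- `η` is nonzero, and is determined up to a factor by the elements of `S` orthogonal to it. -/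
def IsFacetNormal (X : ι → Fin n → ℝ) (S : Finset ι) (η : Fin n → ℝ) : Prop :=
  η ≠ 0 ∧ ∀ ζ, (∀ i ∈ S, X i ⬝ᵥ η = 0 → X i ⬝ᵥ ζ = 0) → ∃ c : ℝ, ζ = c • η

/-- The number of elements of `S` that are not orthogonal to `η`. -/
noncomputable def nonorthCard (X : ι → Fin n → ℝ) (S : Finset ι) (η : Fin n → ℝ) : ℕ :=
  (S.filter fun i => X i ⬝ᵥ η ≠ 0).card

/-- The polynomials that on each line through `A^⊥`, in the direction of a facet normal `η`
orthogonal to `A`, have degree less than the number of elements of `S` not orthogonal to `η`. -/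
noncomputable def facetKer [DecidableEq ι] (X : ι → Fin n → ℝ) (A S : Finset ι) :
    Submodule ℂ (Poly n) where
  carrier := {f | ∀ η, IsFacetNormal X (A ∪ S) η → (∀ i ∈ A, X i ⬝ᵥ η = 0) →
    ∀ t, (∀ i ∈ A, X i ⬝ᵥ t = 0) → lineHom t η f ∈ Polynomial.degreeLT ℂ (nonorthCard X S η)}
  add_mem' hf hg η h1 h2 t ht := by
    rw [map_add]
    exact add_mem (hf η h1 h2 t ht) (hg η h1 h2 t ht)
  zero_mem' η _ _ t _ := by rw [map_zero]; exact zero_mem _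
  smul_mem' c f hf η h1 h2 t ht := by
    rw [map_smul]
    exact Submodule.smul_mem _ c (hf η h1 h2 t ht)

/-- The span of the products `p_{y B}`, with `B` a basis between `A` and `A ∪ S`. -/
noncomputable def shortSpan [DecidableEq ι] (X : ι → Fin n → ℝ) (A S : Finset ι) (y : Finset ι → Finset ι) :
    Submodule ℂ (Poly n) :=
  Submodule.span ℂ ((fun B => prodForm X (y B)) '' basesBetween X A S)

variable {X : ι → Fin n → ℝ}

theorem eq_zero_of_mem_bases {B : Finset ι} (hB : B ∈ bases X) {u : Fin n → ℝ}
    (h : ∀ i ∈ B, X i ⬝ᵥ u = 0) : u = 0 :=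
  span_eq_top_iff_dotProduct.1 hB.2 u (by rintro _ ⟨i, hi, rfl⟩; exact h i hi)

theorem degree_lineHom_prodForm_le (Y : Finset ι) (t η : Fin n → ℝ) :
    (lineHom t η (prodForm X Y)).degree ≤ nonorthCard X Y η := by
  rw [prodForm, map_prod, nonorthCard, Finset.card_filter, Nat.cast_sum]
  refine (Polynomial.degree_prod_le _ _).trans (Finset.sum_le_sum fun i _ => ?_)
  rw [lineHom_linForm]
  split_ifs with h
  · rw [add_comm]
    exact Polynomial.degree_linear_le
  · rw [not_not] at h
    simpa [h] using Polynomial.degree_C_le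

theorem IsFacetNormal.mono {S T : Finset ι} {η : Fin n → ℝ} (h : IsFacetNormal X S η)
    (hST : S ⊆ T) : IsFacetNormal X T η :=
  ⟨h.1, fun ζ hζ => h.2 ζ fun i hi => hζ i (hST hi)⟩

section

variable [DecidableEq ι]

/-! ### Facet kernels under deletion and contraction. -/

theorem mem_facetKer {A S : Finset ι} {f : Poly n} :
    f ∈ facetKer X A S ↔ ∀ η, IsFacetNormal X (A ∪ S) η → (∀ i ∈ A, X i ⬝ᵥ η = 0) →
      ∀ t, (∀ i ∈ A, X i ⬝ᵥ t = 0) → (lineHom t η f).degree < nonorthCard X S η := by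
  simp only [← Polynomial.mem_degreeLT]
  rfl

theorem orthIdeal_le_facetKer (A S : Finset ι) :
    (orthIdeal X A).restrictScalars ℂ ≤ facetKer X A S := by
  intro f hf
  rw [mem_facetKer]
  intro η _ hη t ht
  rw [lineHom_eq_zero hf ht hη, Polynomial.degree_zero]
  exact WithBot.bot_lt_coe _

/-- Some element of the basis `B` is not orthogonal to `η`. It lies in `S` but not in `Y`, so `p_Y`
has fewer nonconstant factors along `η` than the bound allows. -/
theorem prodForm_mem_facetKer {A S B Y : Finset ι} (hB : B ∈ bases X) (hBS : B ⊆ A ∪ S)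
    (hY : Y ⊆ S) (hYB : Disjoint Y B) : prodForm X Y ∈ facetKer X A S := by
  rw [mem_facetKer]
  intro η hη hA t _
  refine (degree_lineHom_prodForm_le Y t η).trans_lt ?_
  obtain ⟨b, hbB, hb⟩ : ∃ b ∈ B, X b ⬝ᵥ η ≠ 0 := by
    by_contra! h
    exact hη.1 (eq_zero_of_mem_bases hB h)
  have hbS : b ∈ S := (Finset.mem_union.1 (hBS hbB)).resolve_left fun h => hb (hA b h)
  have hbY : b ∉ Y := fun h => Finset.disjoint_left.1 hYB h hbB
  rw [Nat.cast_lt]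
  refine Finset.card_lt_card (Finset.ssubset_iff_of_subset
    (Finset.filter_subset_filter _ hY) |>.2 ⟨b, ?_, ?_⟩)
  · exact Finset.mem_filter.2 ⟨hbS, hb⟩
  · exact fun h => hbY (Finset.mem_filter.1 h).1

theorem nonorthCard_insert_of_ne {S : Finset ι} {x : ι} (hx : x ∉ S) {η : Fin n → ℝ}
    (h : X x ⬝ᵥ η ≠ 0) : nonorthCard X (insert x S) η = nonorthCard X S η + 1 := by
  rw [nonorthCard, Finset.filter_insert, if_pos h, Finset.card_insert_of_notMem, nonorthCard]
  exact fun h' => hx (Finset.mem_filter.1 h').1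

theorem nonorthCard_insert_of_eq {S : Finset ι} {x : ι} {η : Fin n → ℝ}
    (h : X x ⬝ᵥ η = 0) : nonorthCard X (insert x S) η = nonorthCard X S η := by
  rw [nonorthCard, Finset.filter_insert, if_neg (not_not.2 h), nonorthCard]

theorem degree_lineHom_linForm {x t η : Fin n → ℝ} (h : x ⬝ᵥ η ≠ 0) :
    (lineHom t η (linForm x)).degree = 1 := by
  rw [lineHom_linForm, add_comm]
  exact Polynomial.degree_linear (Complex.ofReal_ne_zero.2 h)

/-- If `x` is not orthogonal to `η`, dividing by `p_x` lowers both the degree and the bound by one.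
If it is, the bound is unchanged, `p_x` commutes with differentiation along `η`, and it cancels by
`mem_orthIdeal_of_mul`. -/
theorem mem_facetKer_of_linForm_mul {A S : Finset ι} {x : ι} (hx : x ∉ S) {u : Fin n → ℝ}
    (hu : ∀ i ∈ A, X i ⬝ᵥ u = 0) (hxu : X x ⬝ᵥ u ≠ 0) {h : Poly n}
    (hf : linForm (X x) * h ∈ facetKer X A (insert x S)) : h ∈ facetKer X A S := by
  rw [mem_facetKer] at hf ⊢
  intro η hη hA t ht
  have hη' : IsFacetNormal X (A ∪ insert x S) η :=
    hη.mono (Finset.union_subset_union_right (Finset.subset_insert x S))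
  by_cases hxη : X x ⬝ᵥ η = 0
  · rw [degree_lineHom_lt_iff]
    refine lineHom_eq_zero (mem_orthIdeal_of_mul hu hxu (mem_orthIdeal.2 fun t ht => ?_)) ht hA
    have := hf η hη' hA t ht
    rw [nonorthCard_insert_of_eq hxη, degree_lineHom_lt_iff, diffOp_linForm_pow_mul hxη] at this
    exact eval_eq_zero_of_lineHom this
  · have := hf η hη' hA t ht
    rw [nonorthCard_insert_of_ne hx hxη, map_mul, Polynomial.degree_mul,
      degree_lineHom_linForm hxη, Nat.cast_add, Nat.cast_one, add_comm] at this
    exact lt_of_add_lt_add_right this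

theorem facetKer_insert_le {A S : Finset ι} (x : ι) :
    facetKer X A (insert x S) ≤ facetKer X (insert x A) S := by
  intro f hf
  rw [mem_facetKer] at hf ⊢
  intro η hη hA t ht
  rw [← nonorthCard_insert_of_eq (hA x (Finset.mem_insert_self x A))]
  refine hf η ?_ (fun i hi => hA i (Finset.mem_insert_of_mem hi)) t
    (fun i hi => ht i (Finset.mem_insert_of_mem hi))
  rwa [Finset.union_insert, ← Finset.insert_union]

theorem facetKer_insert_le_of_mem_span {A S : Finset ι} {x : ι}
    (hx : X x ∈ Submodule.span ℝ (X '' A)) :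
    facetKer X A (insert x S) ≤ facetKer X A S := by
  intro f hf
  rw [mem_facetKer] at hf ⊢
  intro η hη hA t ht
  rw [← nonorthCard_insert_of_eq (x := x)]
  · exact hf η (hη.mono (Finset.union_subset_union_right (Finset.subset_insert x S))) hA t ht
  · exact dotProduct_eq_zero_of_mem_span (by rintro _ ⟨i, hi, rfl⟩; exact hA i hi) hx

/-- Here `x` is a coloop: a normal `η` to `A ∪ S` is a facet normal with `x` the only element not
orthogonal to it. So `p_x h` is constant along `η`, while `p_x` has degree one there, which forces
`h = 0` on these lines. -/
theorem mem_orthIdeal_of_not_spanning {A S : Finset ι} {x : ι} (hx : x ∉ S)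
    (hS : Submodule.span ℝ (X '' ↑(A ∪ insert x S)) = ⊤)
    (hS' : Submodule.span ℝ (X '' ↑(A ∪ S)) ≠ ⊤) {h : Poly n}
    (hf : linForm (X x) * h ∈ facetKer X A (insert x S)) : h ∈ orthIdeal X A := by
  rw [span_eq_top_iff_dotProduct] at hS
  rw [Ne, span_eq_top_iff_dotProduct] at hS'
  push Not at hS'
  obtain ⟨η, hη, hη0⟩ := hS'
  have hη' : ∀ i ∈ A ∪ S, X i ⬝ᵥ η = 0 := fun i hi => hη _ ⟨i, hi, rfl⟩
  have hext : ∀ ζ, (∀ i ∈ A ∪ S, X i ⬝ᵥ ζ = 0) → X x ⬝ᵥ ζ = 0 → ζ = 0 := by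
    intro ζ h1 h2
    refine hS ζ ?_
    rintro _ ⟨i, hi, rfl⟩
    rw [Finset.mem_coe, Finset.union_insert, Finset.mem_insert] at hi
    rcases hi with rfl | hi
    exacts [h2, h1 i hi]
  have hxη : X x ⬝ᵥ η ≠ 0 := fun h => hη0 (hext η hη' h)
  have hfacet : IsFacetNormal X (A ∪ insert x S) η := by
    refine ⟨hη0, fun ζ hζ => ⟨(X x ⬝ᵥ ζ) / (X x ⬝ᵥ η), ?_⟩⟩
    rw [← sub_eq_zero]
    refine hext _ (fun i hi => ?_) ?_
    · rw [dotProduct_sub, dotProduct_smul, hη' i hi, smul_zero, sub_zero]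
      exact hζ i (Finset.union_subset_union_right (Finset.subset_insert x S) hi) (hη' i hi)
    · rw [dotProduct_sub, dotProduct_smul, smul_eq_mul, div_mul_cancel₀ _ hxη, sub_self]
  have hcard : nonorthCard X (insert x S) η = 1 := by
    rw [nonorthCard_insert_of_ne hx hxη, Nat.add_eq_right, nonorthCard, Finset.card_eq_zero,
      Finset.filter_eq_empty_iff]
    exact fun i hi => not_not.2 (hη' i (Finset.mem_union_right _ hi))
  refine mem_orthIdeal.2 fun t ht => eval_eq_zero_of_lineHom (η := η) ?_
  have := mem_facetKer.1 hf η hfacet (fun i hi => hη' i (Finset.mem_union_left _ hi)) t ht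
  rw [hcard, map_mul, Polynomial.degree_mul, degree_lineHom_linForm hxη, Nat.cast_one] at this
  by_contra h0
  rw [Polynomial.degree_eq_natDegree h0] at this
  norm_cast at this
  lia

/-! ### Bases and long subsets -/

theorem mem_basesBetween_insert {A S B : Finset ι} {x : ι} :
    B ∈ basesBetween X A (insert x S) ↔
      (x ∈ B ∧ B ∈ basesBetween X (insert x A) S) ∨ (x ∉ B ∧ B ∈ basesBetween X A S) := by
  simp only [basesBetween, Set.mem_ofPred_eq, Finset.insert_subset_iff, Finset.union_insert,
    Finset.insert_union]
  by_cases hx : x ∈ B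
  · simp [hx]
  · simp [hx, Finset.subset_insert_iff_of_notMem hx]

theorem basesBetween_insert_of_mem_span {A S : Finset ι} {x : ι} (hxS : x ∉ S) (hxA : x ∉ A)
    (hx : X x ∈ Submodule.span ℝ (X '' A)) :
    basesBetween X A (insert x S) = basesBetween X A S := by
  ext B
  rw [mem_basesBetween_insert]
  have hB : B ∉ basesBetween X (insert x A) S := fun h => by
    have h1 : LinearIndepOn ℝ X (B : Set ι) := h.1.1
    have h2 := h1.mono (Finset.coe_subset.2 h.2.1)
    rw [Finset.coe_insert, linearIndepOn_insert (by simpa using hxA)] at h2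
    exact h2.2 hx
  constructor
  · rintro (⟨-, h⟩ | ⟨-, h⟩)
    exacts [(hB h).elim, h]
  · refine fun h => Or.inr ⟨fun hxB => ?_, h⟩
    rcases Finset.mem_union.1 (h.2.2 hxB) with h | h
    exacts [hxA h, hxS h]

theorem exists_basis_between {A B : Finset ι} (hA : LinearIndepOn ℝ X (A : Set ι))
    (hB : B ∈ bases X) : ∃ B' ∈ bases X, A ⊆ B' ∧ B' ⊆ A ∪ B := by
  obtain ⟨b, hb, hAb, hspan, hli⟩ :=
    exists_linearIndepOn_extension hA (Set.subset_union_left (t := (B : Set ι)))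
  have hfin : b.Finite := (A ∪ B).finite_toSet.subset (by simpa using hb)
  lift b to Finset ι using hfin
  refine ⟨b, ⟨hli, ?_⟩, by exact_mod_cast hAb, by exact_mod_cast hb⟩
  rw [eq_top_iff, ← hB.2]
  exact Submodule.span_le.2 ((Set.image_mono Set.subset_union_right).trans hspan)

/-- Exchange: from a basis `B` containing `A`, complete `A ∪ {x}` to a basis using elements of `B`.
The set `Y` meets the new basis outside `x`, hence inside `B`. -/
theorem longIdeal_insert_left_le {A S : Finset ι} {x : ι} (hxS : x ∉ S) (hxA : x ∉ A)
    (hAx : LinearIndepOn ℝ X (insert x A : Finset ι)) :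
    longIdeal X (insert x A) S ≤ longIdeal X A (insert x S) := by
  refine Ideal.span_mono (Set.image_mono ?_)
  rintro Y ⟨hY, h⟩
  refine ⟨hY.trans (Finset.subset_insert x S), fun B hB => ?_⟩
  obtain ⟨B', hB', h1, h2⟩ := exists_basis_between hAx hB.1
  have h3 : B' ⊆ insert x A ∪ S := by
    refine h2.trans (Finset.union_subset Finset.subset_union_left ?_)
    rw [Finset.insert_union, ← Finset.union_insert]
    exact hB.2.2
  obtain ⟨i, hiY, hi⟩ := h B' ⟨hB', h1, h3⟩
  refine ⟨i, hiY, ?_⟩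
  rcases Finset.mem_union.1 (h2 hi) with h4 | h4
  · rcases Finset.mem_insert.1 h4 with rfl | h4
    · exact (hxS (hY hiY)).elim
    · exact hB.2.1 h4
  · exact h4

theorem linForm_mul_mem_longIdeal {A S : Finset ι} {x : ι} (hxS : x ∉ S) {j : Poly n}
    (hj : j ∈ longIdeal X A S) : linForm (X x) * j ∈ longIdeal X A (insert x S) := by
  induction hj using Submodule.span_induction with
  | mem p hp =>
    obtain ⟨Y, ⟨hY, h⟩, rfl⟩ := hp
    refine Ideal.subset_span ⟨insert x Y, ⟨Finset.insert_subset_insert x hY, fun B hB => ?_⟩, ?_⟩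
    · rcases (mem_basesBetween_insert).1 hB with ⟨h1, -⟩ | ⟨-, h1⟩
      · exact ⟨x, Finset.mem_insert_self x Y, h1⟩
      · obtain ⟨i, hi, hi'⟩ := h B h1
        exact ⟨i, Finset.mem_insert_of_mem hi, hi'⟩
    · exact Finset.prod_insert fun h => hxS (hY h)
  | zero => simp
  | add p q _ _ hp hq => rw [mul_add]; exact add_mem hp hq
  | smul a p _ hp =>
    rw [smul_eq_mul, mul_left_comm]
    exact Ideal.mul_mem_left _ a hp

/-- The deletion–contraction step for the span of a family of short products. -/
theorem shortSpan_insert {A S : Finset ι} {x : ι} (hxS : x ∉ S) (hxA : x ∉ A)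
    {y₀ y₁ : Finset ι → Finset ι} (h₀ : ∀ B ∈ basesBetween X A S, y₀ B ⊆ S) :
    let y := fun B => if x ∈ B then y₁ B else insert x (y₀ B)
    shortSpan X (insert x A) S y₁ ≤ shortSpan X A (insert x S) y ∧
      ∀ g ∈ shortSpan X A S y₀, linForm (X x) * g ∈ shortSpan X A (insert x S) y := by
  intro y
  constructor
  · refine Submodule.span_le.2 ?_
    rintro _ ⟨B, hB, rfl⟩
    have hxB : x ∈ B := hB.2.1 (Finset.mem_insert_self x A)
    refine Submodule.subset_span ⟨B, (mem_basesBetween_insert).2 (Or.inl ⟨hxB, hB⟩), ?_⟩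
    simp [y, hxB]
  · intro g hg
    induction hg using Submodule.span_induction with
    | mem p hp =>
      obtain ⟨B, hB, rfl⟩ := hp
      have hxB : x ∉ B := fun h => by
        rcases Finset.mem_union.1 (hB.2.2 h) with h | h
        exacts [hxA h, hxS h]
      refine Submodule.subset_span ⟨B, (mem_basesBetween_insert).2 (Or.inr ⟨hxB, hB⟩), ?_⟩
      simp only [y, if_neg hxB]
      exact Finset.prod_insert fun h => hxS (h₀ B hB h)
    | zero => simp
    | add p q _ _ hp hq => rw [mul_add]; exact add_mem hp hq
    | smul a p _ hp => rw [mul_smul_comm]; exact Submodule.smul_mem _ a hp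

/-- One short product for each basis, such that these span a complement of the ideal of the long
products, and span the joint kernel of the powers of the facet normals. -/
theorem exists_short_family (S : Finset ι) : ∀ A : Finset ι, Disjoint A S →
    LinearIndepOn ℝ X (A : Set ι) → ∃ y : Finset ι → Finset ι,
      (∀ B ∈ basesBetween X A S, y B ⊆ S ∧ Disjoint (y B) B) ∧
      (∀ f, ∃ g ∈ shortSpan X A S y, ∃ j ∈ longIdeal X A S, f - (g + j) ∈ orthIdeal X A) ∧
      (Submodule.span ℝ (X '' ↑(A ∪ S)) = ⊤ → ∀ f ∈ facetKer X A S,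
        ∃ g ∈ shortSpan X A S y, f - g ∈ orthIdeal X A) := by
  induction S using Finset.induction_on with
  | empty =>
    intro A _ hA
    have key : Submodule.span ℝ (X '' ↑(A ∪ ∅)) = ⊤ → ∀ f : Poly n,
        ∃ g ∈ shortSpan X A ∅ (fun _ => ∅), f - g ∈ orthIdeal X A := by
      intro h f
      rw [Finset.union_empty] at h
      -- Since `A` is a basis, `A^⊥` is the origin, where `f` agrees with the constant `f(0)`, and
      -- `p_∅ = 1`.
      refine ⟨MvPolynomial.eval (toComplex 0) f • prodForm X ∅, Submodule.smul_mem _ _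
        (Submodule.subset_span ⟨A, ⟨⟨hA, h⟩, subset_rfl, by simp⟩, rfl⟩), ?_⟩
      refine mem_orthIdeal.2 fun t ht => ?_
      obtain rfl := eq_zero_of_mem_bases ⟨hA, h⟩ ht
      simp [prodForm]
    refine ⟨fun _ => ∅, fun B _ => ⟨subset_rfl, Finset.disjoint_empty_left B⟩, fun f => ?_,
      fun h f _ => key h f⟩
    by_cases h : Submodule.span ℝ (X '' ↑(A ∪ ∅)) = ⊤
    · obtain ⟨g, hg, hfg⟩ := key h f
      exact ⟨g, hg, 0, zero_mem _, by simpa using hfg⟩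
    · refine ⟨0, zero_mem _, f, ?_, by simp⟩
      -- Without bases the empty set is vacuously long, and its product is `1`.
      have h1 : longIdeal X A ∅ = ⊤ := by
        rw [Ideal.eq_top_iff_one]
        refine Ideal.subset_span ⟨∅, ⟨subset_rfl, fun B hB => (h ?_).elim⟩, rfl⟩
        rw [← hB.1.2, Finset.union_empty]
        have := hB.2.2
        rw [Finset.union_empty] at this
        rw [this.antisymm hB.2.1]
      rw [h1]
      trivial
  | insert x S hxS ih =>
    intro A hAS hA
    rw [Finset.disjoint_insert_right] at hAS
    obtain ⟨hxA, hAS⟩ := hAS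
    obtain ⟨y₀, h₀, hJ₀, hK₀⟩ := ih A hAS hA
    by_cases hx : X x ∈ Submodule.span ℝ (X '' A)
    · have hb := basesBetween_insert_of_mem_span hxS hxA hx
      have hspan : shortSpan X A (insert x S) y₀ = shortSpan X A S y₀ := by
        rw [shortSpan, hb, shortSpan]
      refine ⟨y₀, fun B hB => ?_, fun f => ?_, fun hs f hf => ?_⟩
      · rw [hb] at hB
        exact ⟨(h₀ B hB).1.trans (Finset.subset_insert x S), (h₀ B hB).2⟩
      · obtain ⟨g, hg, j, hj, h⟩ := hJ₀ f
        refine ⟨g, hspan ▸ hg, j, Ideal.span_mono (Set.image_mono ?_) hj, h⟩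
        rintro Y ⟨hY, hY'⟩
        exact ⟨hY.trans (Finset.subset_insert x S), hb ▸ hY'⟩
      · rw [hspan]
        refine hK₀ ?_ f (facetKer_insert_le_of_mem_span hx hf)
        refine eq_top_iff.2 (hs ▸ Submodule.span_le.2 ?_)
        rintro _ ⟨i, hi, rfl⟩
        rw [Finset.mem_coe, Finset.union_insert, Finset.mem_insert] at hi
        rcases hi with rfl | hi
        · exact Submodule.span_mono (Set.image_mono (by simp)) hx
        · exact Submodule.subset_span ⟨i, hi, rfl⟩
    · have hAx : LinearIndepOn ℝ X (insert x A : Finset ι) := by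
        rw [Finset.coe_insert]
        exact hA.insert hx
      obtain ⟨u, hxu, hu'⟩ := exists_dotProduct_ne_zero hx
      have hu : ∀ i ∈ A, X i ⬝ᵥ u = 0 := fun i hi => hu' _ (Submodule.subset_span ⟨i, hi, rfl⟩)
      obtain ⟨y₁, h₁, hJ₁, hK₁⟩ := ih (insert x A) (Finset.disjoint_insert_left.2 ⟨hxS, hAS⟩) hAx
      obtain ⟨hs₁, hs₀⟩ := shortSpan_insert hxS hxA (y₁ := y₁) fun B hB => (h₀ B hB).1
      have hy : ∀ B ∈ basesBetween X A (insert x S),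
          (if x ∈ B then y₁ B else insert x (y₀ B)) ⊆ insert x S ∧
            Disjoint (if x ∈ B then y₁ B else insert x (y₀ B)) B := fun B hB => by
        rcases (mem_basesBetween_insert).1 hB with ⟨hxB, hB⟩ | ⟨hxB, hB⟩
        · rw [if_pos hxB]
          exact ⟨(h₁ B hB).1.trans (Finset.subset_insert x S), (h₁ B hB).2⟩
        · rw [if_neg hxB]
          exact ⟨Finset.insert_subset_insert x (h₀ B hB).1,
            Finset.disjoint_insert_left.2 ⟨hxB, (h₀ B hB).2⟩⟩
      refine ⟨fun B => if x ∈ B then y₁ B else insert x (y₀ B), hy, fun f => ?_, fun hs f hf => ?_⟩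
      · obtain ⟨g, hg, j, hj, h⟩ := hJ₁ f
        obtain ⟨r, hr⟩ := exists_mul_sub_mem_orthIdeal hu hxu h
        obtain ⟨g', hg', j', hj', h'⟩ := hJ₀ r
        refine ⟨g + linForm (X x) * g', add_mem (hs₁ hg) (hs₀ g' hg'), j + linForm (X x) * j',
          add_mem (longIdeal_insert_left_le hxS hxA hAx hj) (linForm_mul_mem_longIdeal hxS hj'),
          ?_⟩
        convert add_mem hr (Ideal.mul_mem_left _ (linForm (X x)) h') using 1
        ring
      · have hs' : Submodule.span ℝ (X '' ↑(insert x A ∪ S)) = ⊤ := by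
          rwa [Finset.insert_union, ← Finset.union_insert]
        obtain ⟨g, hg, h⟩ := hK₁ hs' f (facetKer_insert_le x hf)
        obtain ⟨r, hr⟩ := exists_mul_sub_mem_orthIdeal hu hxu h
        -- The contracted part `g` satisfies the uncontracted degree bounds too, so these pass to
        -- the remainder `p_x r` and can then be divided by `p_x`.
        have hgK : g ∈ facetKer X A (insert x S) := by
          refine (Submodule.span_le.2 ?_) hg
          rintro _ ⟨B, hB, rfl⟩
          refine prodForm_mem_facetKer hB.1 ?_ ((h₁ B hB).1.trans (Finset.subset_insert x S))
            (h₁ B hB).2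
          rw [Finset.union_insert, ← Finset.insert_union]
          exact hB.2.2
        have hrK : linForm (X x) * r ∈ facetKer X A (insert x S) := by
          have := sub_mem (sub_mem hf hgK) (orthIdeal_le_facetKer A (insert x S) hr)
          rwa [sub_sub_cancel] at this
        obtain ⟨g', hg', h'⟩ : ∃ g' ∈ shortSpan X A S y₀, r - g' ∈ orthIdeal X A := by
          -- The induction hypothesis on facet kernels needs `A ∪ S` to span; when it does not, `r`
          -- itself vanishes on `A^⊥`.
          by_cases hS : Submodule.span ℝ (X '' ↑(A ∪ S)) = ⊤
          · exact hK₀ hS r (mem_facetKer_of_linForm_mul hxS hu hxu hrK)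
          · exact ⟨0, zero_mem _, by simpa using mem_orthIdeal_of_not_spanning hxS hs hS hrK⟩
        refine ⟨g + linForm (X x) * g', add_mem (hs₁ hg) (hs₀ g' hg'), ?_⟩
        convert add_mem hr (Ideal.mul_mem_left _ (linForm (X x)) h') using 1
        ring

end

/-! ## Bases and vertices -/

theorem exists_basis_subset {T : Finset ι} (hT : Submodule.span ℝ (X '' T) = ⊤) :
    ∃ B ∈ bases X, B ⊆ T := by
  obtain ⟨b, hb, -, hspan, hli⟩ :=
    exists_linearIndepOn_extension (linearIndepOn_empty ℝ X) (Set.empty_subset (T : Set ι))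
  have hfin : b.Finite := T.finite_toSet.subset hb
  lift b to Finset ι using hfin
  refine ⟨b, ⟨hli, ?_⟩, by exact_mod_cast hb⟩
  rw [eq_top_iff, ← hT]
  exact Submodule.span_le.2 hspan

theorem card_of_mem_bases {B : Finset ι} (hB : B ∈ bases X) : B.card = n := by
  have hspan : ⊤ ≤ Submodule.span ℝ (Set.range fun b : B => X b) := by
    rw [← hB.2]
    refine Submodule.span_mono ?_
    rintro _ ⟨i, hi, rfl⟩
    exact ⟨⟨i, hi⟩, rfl⟩
  have := Module.finrank_eq_card_basis (Module.Basis.mk hB.1 hspan)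
  simpa using this.symm

theorem exists_dotProduct_eq {B : Finset ι} (hB : B ∈ bases X) (c : ι → ℝ) :
    ∃ v, ∀ i ∈ B, X i ⬝ᵥ v = c i := by
  let T := (Matrix.of fun i : B => X i).mulVecLin
  have hT : Function.Injective T := by
    rw [← LinearMap.ker_eq_bot, LinearMap.ker_eq_bot']
    exact fun v hv => eq_zero_of_mem_bases hB fun i hi => congrFun hv ⟨i, hi⟩
  have hcard : Module.finrank ℝ (Fin n → ℝ) = Module.finrank ℝ (B → ℝ) := by
    simp [card_of_mem_bases hB]
  obtain ⟨v, hv⟩ := (LinearMap.injective_iff_surjective_of_finrank_eq_finrank hcard).1 hT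
    fun i => c i
  exact ⟨v, fun i hi => congrFun hv ⟨i, hi⟩⟩

theorem eq_of_mem_bases {B : Finset ι} (hB : B ∈ bases X) {u v : Fin n → ℝ}
    (h : ∀ i ∈ B, X i ⬝ᵥ u = X i ⬝ᵥ v) : u = v :=
  sub_eq_zero.1 (eq_zero_of_mem_bases hB fun i hi => by rw [dotProduct_sub, h i hi, sub_self])

/-- For generic `λ`, each basis determines a vertex that lies on no further hyperplane, and all
vertices are of this kind. -/
theorem Generic.exists_vertex {lam : ι → ℝ} (h : Generic X lam) :
    ∃ v : Finset ι → Fin n → ℝ, (∀ B ∈ bases X, ∀ i, X i ⬝ᵥ v B = lam i ↔ i ∈ B) ∧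
      vertices X lam = v '' bases X := by
  classical
  have hex : ∀ B, ∃ v, B ∈ bases X → ∀ i ∈ B, X i ⬝ᵥ v = lam i := fun B => by
    by_cases hB : B ∈ bases X
    · exact (exists_dotProduct_eq hB lam).imp fun v hv _ => hv
    · exact ⟨0, fun h => (hB h).elim⟩
  choose v hv using hex
  refine ⟨v, fun B hB i => ⟨fun hi => ?_, hv B hB i⟩, Set.Subset.antisymm ?_ ?_⟩
  · by_contra hiB
    have h1 := h (insert i B) (by rw [Finset.card_insert_of_notMem hiB, card_of_mem_bases hB])
    rw [← Set.mem_empty_iff_false (v B), ← h1]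
    simp only [Set.mem_iInter, Finset.mem_insert]
    rintro j (rfl | hj)
    exacts [hi, hv B hB j hj]
  · rintro w ⟨s, hs⟩
    have hw : ∀ i ∈ s, X i ⬝ᵥ w = lam i := by
      have : w ∈ ⋂ i ∈ s, hyperplane X lam i := hs ▸ rfl
      rw [Set.mem_iInter₂] at this
      exact this
    have hspan : Submodule.span ℝ (X '' s) = ⊤ := by
      rw [span_eq_top_iff_dotProduct]
      intro u hu
      -- A direction orthogonal to all of `s` would move the vertex within the intersection.
      have : w + u ∈ ⋂ i ∈ s, hyperplane X lam i := by
        simp only [Set.mem_iInter]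
        intro i hi
        change X i ⬝ᵥ (w + u) = lam i
        rw [dotProduct_add, hw i hi, hu _ ⟨i, hi, rfl⟩, add_zero]
      rw [hs] at this
      simpa using this
    obtain ⟨B, hB, hBs⟩ := exists_basis_subset hspan
    refine ⟨B, hB, eq_of_mem_bases hB fun i hi => ?_⟩
    rw [hv B hB i hi, hw i (hBs hi)]
  · rintro _ ⟨B, hB, rfl⟩
    refine ⟨B, Set.Subset.antisymm (fun w hw => ?_) ?_⟩
    · simp only [Set.mem_iInter] at hw
      refine eq_of_mem_bases hB fun i hi => ?_
      rw [hv B hB i hi]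
      exact hw i hi
    · rw [Set.singleton_subset_iff]
      simp only [Set.mem_iInter]
      exact hv B hB

/-- For each set `s` of `n + 1` indices, the `λ` whose hyperplanes over `s` share a point form a
subspace, proper because the image of `ℝⁿ` in `ℝˢ` is. Finitely many proper real subspaces do not
cover the whole space. -/
theorem exists_generic [Fintype ι] (X : ι → Fin n → ℝ) : ∃ lam, Generic X lam := by
  classical
  let T := fun s : Finset ι => (Matrix.of fun i : s => X i).mulVecLin
  let R := fun s : Finset ι => LinearMap.funLeft ℝ ℝ (fun i : s => (i : ι))
  let W := fun s : Finset ι => (LinearMap.range (T s)).comap (R s)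
  have hW : ⊤ ∉ (Finset.univ.filter fun s : Finset ι => s.card = n + 1).image W := by
    intro h
    obtain ⟨s, hs, h⟩ := Finset.mem_image.1 h
    replace hs := (Finset.mem_filter.1 hs).2
    have hR : Function.Surjective (R s) :=
      LinearMap.funLeft_surjective_of_injective _ _ _ Subtype.val_injective
    have hT : Function.Surjective (T s) := by
      intro c
      obtain ⟨d, rfl⟩ := hR c
      have : d ∈ W s := h ▸ Submodule.mem_top
      exact this
    have := LinearMap.finrank_le_finrank_of_surjective hT
    simp [hs] at this
  obtain ⟨lam, hlam⟩ := (Set.ne_univ_iff_exists_notMem _).1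
    (Subspace.biUnion_ne_univ_of_top_notMem hW)
  refine ⟨lam, fun s hs => Set.eq_empty_of_forall_notMem fun t ht => hlam ?_⟩
  simp only [Set.mem_iInter] at ht
  refine Set.mem_biUnion (x := W s) ?_ ?_
  · exact Finset.mem_image_of_mem W (by simpa using hs)
  · exact ⟨t, funext fun i => ht i i.2⟩

/-! ## Facets and their normals -/

theorem isFacetNormal_of_mem_facets [Fintype ι] {H : Submodule ℝ (Fin n → ℝ)} (hH : H ∈ facets X)
    {η : Fin n → ℝ} (hη : η ≠ 0) (hηH : ∀ h ∈ H, η ⬝ᵥ h = 0) :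
    IsFacetNormal X Finset.univ η ∧ mult X H = nonorthCard X Finset.univ η := by
  have hmem : ∀ v, v ∈ H ↔ v ⬝ᵥ η = 0 := by
    refine fun v => ⟨fun hv => by rw [dotProduct_comm, hηH v hv], fun hv => ?_⟩
    by_contra hvH
    -- By dimension, `H` and a further vector of `η^⊥` would span everything, making `η` orthogonal
    -- to itself.
    have hlt : H < H ⊔ Submodule.span ℝ {v} := by
      refine lt_of_le_of_ne le_sup_left fun h => hvH ?_
      rw [h]
      exact (le_sup_right : _ ≤ H ⊔ _) (Submodule.mem_span_singleton_self v)
    have h1 := Submodule.finrank_lt_finrank_of_lt hlt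
    have h2 := Submodule.finrank_le (H ⊔ Submodule.span ℝ {v})
    have h3 := hH.1
    have htop : H ⊔ Submodule.span ℝ {v} = ⊤ := by
      apply Submodule.eq_top_of_finrank_eq
      rw [Module.finrank_fin_fun] at h2 ⊢
      lia
    obtain ⟨a, ha, b, hb, hab⟩ := Submodule.mem_sup.1
      (htop ▸ Submodule.mem_top : η ∈ H ⊔ Submodule.span ℝ {v})
    obtain ⟨c, rfl⟩ := Submodule.mem_span_singleton.1 hb
    refine hη (dotProduct_self_eq_zero.1 ?_)
    nth_rewrite 2 [← hab]
    rw [dotProduct_add, hηH a ha, dotProduct_smul, dotProduct_comm, hv, smul_zero, add_zero]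
  refine ⟨⟨hη, fun ζ hζ => ⟨(η ⬝ᵥ ζ) / (η ⬝ᵥ η), ?_⟩⟩, ?_⟩
  · have hζH : ∀ v ∈ H, v ⬝ᵥ ζ = 0 := by
      intro v hv
      rw [← hH.2] at hv
      refine dotProduct_eq_zero_of_mem_span ?_ hv
      rintro _ ⟨⟨i, rfl⟩, hi⟩
      exact hζ i (Finset.mem_univ i) ((hmem _).1 hi)
    have hηη : η ⬝ᵥ η ≠ 0 := fun h => hη (dotProduct_self_eq_zero.1 h)
    have hw : ζ - ((η ⬝ᵥ ζ) / (η ⬝ᵥ η)) • η ∈ H := by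
      rw [hmem, dotProduct_comm, dotProduct_sub, dotProduct_smul, smul_eq_mul,
        div_mul_cancel₀ _ hηη, sub_self]
    rw [← sub_eq_zero, ← dotProduct_self_eq_zero]
    rw [dotProduct_sub, dotProduct_smul, hζH _ hw, (hmem _).1 hw, smul_zero, sub_zero]
  · rw [mult, nonorthCard, ← Set.ncard_coe_finset]
    congr 1
    ext i
    simp [hmem]

/-- If the elements of `X` in `η^⊥` did not span it, some `u` would be orthogonal to all of them but
not to all of `η^⊥`. Uniqueness makes `u` a multiple of `η`, a contradiction. -/
theorem IsFacetNormal.exists_facet [Fintype ι] {η : Fin n → ℝ}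
    (h : IsFacetNormal X Finset.univ η) : ∃ H ∈ facets X, ∀ v ∈ H, η ⬝ᵥ v = 0 := by
  have hφ : dotProductEquiv ℝ (Fin n) η ≠ 0 := by simpa using h.1
  refine ⟨LinearMap.ker (dotProductEquiv ℝ (Fin n) η), ⟨?_, ?_⟩, fun v hv => hv⟩
  · rw [Module.Dual.finrank_ker_add_one_of_ne_zero hφ, Module.finrank_fin_fun]
  · refine le_antisymm (Submodule.span_le.2 Set.inter_subset_right) fun v hv => ?_
    by_contra hv'
    obtain ⟨u, hvu, hu⟩ := exists_dotProduct_ne_zero hv'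
    obtain ⟨c, rfl⟩ := h.2 u fun i _ hi => hu _ (Submodule.subset_span
      ⟨⟨i, rfl⟩, (dotProduct_comm _ _).trans hi⟩)
    refine hvu ?_
    rw [dotProduct_smul, dotProduct_comm, show η ⬝ᵥ v = 0 from hv, smul_zero]

theorem mem_polyKer_I [Fintype ι] {f : Poly n} :
    f ∈ polyKer (I X) ↔ ∀ η, IsFacetNormal X Finset.univ η →
      diffOp (linForm η ^ nonorthCard X Finset.univ η) f = 0 := by
  rw [I, mem_polyKer_span]
  constructor
  · intro h η hη
    obtain ⟨H, hH, hηH⟩ := hη.exists_facet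
    rw [← (isFacetNormal_of_mem_facets hH hη.1 hηH).2]
    exact h _ ⟨H, hH, η, hη.1, hηH, rfl⟩
  · rintro h _ ⟨H, hH, η, hη, hηH, rfl⟩
    obtain ⟨h1, h2⟩ := isFacetNormal_of_mem_facets hH hη hηH
    rw [h2]
    exact h η h1

theorem facetKer_univ [Fintype ι] [DecidableEq ι] :
    facetKer X ∅ Finset.univ = polyKer (I X) := by
  ext f
  rw [mem_facetKer, mem_polyKer_I, Finset.empty_union]
  constructor
  · intro h η hη
    refine orthIdeal_empty (X := X) (mem_orthIdeal.2 fun t ht =>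
      eval_eq_zero_of_lineHom (η := η) ?_)
    rw [← degree_lineHom_lt_iff]
    exact h η hη (by simp) t ht
  · intro h η hη _ t _
    rw [degree_lineHom_lt_iff, h η hη, map_zero]

/-! ## The varieties of the two ideals -/

theorem eval_linForm_re (x : Fin n → ℝ) (α : Fin n → ℂ) :
    (MvPolynomial.eval α (linForm x)).re = x ⬝ᵥ fun k => (α k).re := by
  simp [linForm, dotProduct]

theorem eval_linForm_im (x : Fin n → ℝ) (α : Fin n → ℂ) :
    (MvPolynomial.eval α (linForm x)).im = x ⬝ᵥ fun k => (α k).im := by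
  simp [linForm, dotProduct]

theorem eval_linForm_zero (x : Fin n → ℝ) : MvPolynomial.eval 0 (linForm x) = 0 := by
  simp [linForm]

theorem eq_zero_of_eval_linForm {s : Set (Fin n → ℝ)}
    (hs : ∀ t, (∀ x ∈ s, x ⬝ᵥ t = 0) → t = 0) {α : Fin n → ℂ}
    (h : ∀ x ∈ s, MvPolynomial.eval α (linForm x) = 0) : α = 0 := by
  have h1 := hs (fun k => (α k).re) fun x hx => by rw [← eval_linForm_re, h x hx, Complex.zero_re]
  have h2 := hs (fun k => (α k).im) fun x hx => by rw [← eval_linForm_im, h x hx, Complex.zero_im]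
  exact funext fun k => Complex.ext (congrFun h1 k) (congrFun h2 k)

theorem mem_zeroLocus_span {S : Set (Poly n)} {α : Fin n → ℂ} :
    α ∈ MvPolynomial.zeroLocus ℂ (Ideal.span S) ↔ ∀ p ∈ S, MvPolynomial.eval α p = 0 := by
  rw [MvPolynomial.mem_zeroLocus_iff]
  refine ⟨fun h p hp => h p (Ideal.subset_span hp), fun h p hp => ?_⟩
  induction hp using Submodule.span_induction with
  | mem x hx => exact h x hx
  | zero => simp
  | add x y _ _ hx hy => rw [map_add, hx, hy, add_zero]
  | smul a x _ hx => rw [smul_eq_mul, map_mul, hx, mul_zero]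

theorem zeroLocus_J [Fintype ι] {B₀ : Finset ι} (hB₀ : B₀ ∈ bases X) :
    MvPolynomial.zeroLocus ℂ (J X) = {0} := by
  classical
  ext α
  rw [J, mem_zeroLocus_span, Set.mem_singleton_iff]
  constructor
  · intro h
    -- The product over this set is nonzero at `α`, so the set misses some basis, all of whose forms
    -- vanish at `α`.
    have hY : (Finset.univ.filter fun i => MvPolynomial.eval α (linForm (X i)) ≠ 0) ∉ long X := by
      intro hY
      have := h _ ⟨_, hY, rfl⟩
      rw [prodForm, map_prod, Finset.prod_eq_zero_iff] at this
      obtain ⟨i, hi, hi'⟩ := this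
      exact (Finset.mem_filter.1 hi).2 hi'
    simp only [long, Set.mem_ofPred_eq, Finset.mem_filter, Finset.mem_univ, true_and] at hY
    push Not at hY
    obtain ⟨B, hB, hBα⟩ := hY
    refine eq_zero_of_eval_linForm (s := X '' B)
      (fun t ht => eq_zero_of_mem_bases hB fun i hi => ht _ ⟨i, hi, rfl⟩) ?_
    rintro _ ⟨i, hi, rfl⟩
    by_contra h'
    exact hBα i h' hi
  · rintro rfl _ ⟨Y, hY, rfl⟩
    obtain ⟨i, hi, -⟩ := hY B₀ hB₀
    rw [prodForm, map_prod]
    exact Finset.prod_eq_zero hi (eval_linForm_zero _)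

theorem eq_zero_of_facetNormals [Fintype ι] {B : Finset ι} (hB : B ∈ bases X) {t : Fin n → ℝ}
    (ht : ∀ η, IsFacetNormal X Finset.univ η → η ⬝ᵥ t = 0) : t = 0 := by
  classical
  -- The basis dual to `B`: its members are facet normals and span `ℝⁿ`.
  choose η hη using fun b => exists_dotProduct_eq hB (Pi.single b (1 : ℝ))
  have hexp : ∀ ζ, ζ = ∑ b ∈ B, (X b ⬝ᵥ ζ) • η b := fun ζ => by
    refine eq_of_mem_bases hB fun i hi => ?_
    rw [dotProduct_sum, Finset.sum_eq_single i]
    · rw [dotProduct_smul, hη i i hi, Pi.single_eq_same, smul_eq_mul, mul_one]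
    · intro b _ hbi
      rw [dotProduct_smul, hη b i hi, Pi.single_eq_of_ne hbi.symm, smul_zero]
    · exact fun h => (h hi).elim
  have hfacet : ∀ b ∈ B, IsFacetNormal X Finset.univ (η b) := by
    refine fun b hb => ⟨fun h0 => ?_, fun ζ hζ => ⟨X b ⬝ᵥ ζ, ?_⟩⟩
    · have := hη b b hb
      rw [h0, dotProduct_zero, Pi.single_eq_same] at this
      exact zero_ne_one this
    · conv_lhs => rw [hexp ζ]
      refine Finset.sum_eq_single b (fun i hi hib => ?_) fun h => (h hb).elim
      rw [hζ i (Finset.mem_univ i) (by rw [hη b i hi, Pi.single_eq_of_ne hib]), zero_smul]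
  rw [← dotProduct_self_eq_zero]
  nth_rewrite 1 [hexp t]
  rw [sum_dotProduct]
  refine Finset.sum_eq_zero fun b hb => ?_
  rw [smul_dotProduct, ht _ (hfacet b hb), smul_zero]

theorem zeroLocus_I [Fintype ι] {B : Finset ι} (hB : B ∈ bases X) :
    MvPolynomial.zeroLocus ℂ (I X) = {0} := by
  ext α
  rw [I, mem_zeroLocus_span, Set.mem_singleton_iff]
  constructor
  · intro h
    refine eq_zero_of_eval_linForm (s := {η | IsFacetNormal X Finset.univ η})
      (fun t ht => eq_zero_of_facetNormals hB ht) fun η hη => ?_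
    obtain ⟨H, hH, hηH⟩ := hη.exists_facet
    have := h _ ⟨H, hH, η, hη.1, hηH, rfl⟩
    rw [map_pow] at this
    exact eq_zero_of_pow_eq_zero this
  · rintro rfl _ ⟨H, hH, η, hη, hηH, rfl⟩
    obtain ⟨-, h2⟩ := isFacetNormal_of_mem_facets hH hη hηH
    rw [map_pow, eval_linForm_zero, h2]
    -- The exponent is positive, as no nonzero `η` is orthogonal to a spanning family.
    refine zero_pow fun h0 => hη (eq_zero_of_mem_bases hB fun i _ => ?_)
    rw [nonorthCard, Finset.card_eq_zero, Finset.filter_eq_empty_iff] at h0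
    exact not_not.1 (h0 (Finset.mem_univ i))

/-! ## Short and long products -/

theorem short_of_disjoint {B Y : Finset ι} (hB : B ∈ bases X) (h : Disjoint Y B) : Y ∈ short X := by
  change Module.finrank ℝ (Submodule.span ℝ (X '' {i | i ∉ Y})) = n
  have htop : Submodule.span ℝ (X '' {i | i ∉ Y}) = ⊤ := by
    rw [eq_top_iff, ← hB.2]
    exact Submodule.span_mono (Set.image_mono fun i hi hiY => Finset.disjoint_left.1 h hiY hi)
  rw [htop, finrank_top, Module.finrank_fin_fun]

theorem exists_basis_of_short [Fintype ι] {Y : Finset ι} (hY : Y ∈ short X) :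
    ∃ B ∈ bases X, Disjoint Y B := by
  classical
  have hspan : Submodule.span ℝ (X '' ↑(Finset.univ.filter fun i => i ∉ Y)) = ⊤ := by
    apply Submodule.eq_top_of_finrank_eq
    rw [Module.finrank_fin_fun]
    rw [Finset.coe_filter_univ]
    exact (show Module.finrank ℝ (Submodule.span ℝ (X '' {i | i ∉ Y})) = n from hY)
  obtain ⟨B, hB, hBY⟩ := exists_basis_subset hspan
  exact ⟨B, hB, Finset.disjoint_right.2 fun i hi => (Finset.mem_filter.1 (hBY hi)).2⟩

theorem D_eq_polyKer : D X = polyKer (J X) := by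
  ext f
  rw [J, mem_polyKer_span, Set.forall_mem_image]
  simp [D]

/-- The basic facts on `𝒫(X)` that come from deletion and contraction. -/
theorem P_structure [Fintype ι] (hX : Submodule.span ℝ (Set.range X) = ⊤) :
    P X = polyKer (I X) ∧ P X ⊔ (J X).restrictScalars ℂ = ⊤ ∧ Module.Finite ℂ (P X) ∧
      Module.finrank ℂ (P X) ≤ (bases X).ncard := by
  classical
  obtain ⟨y, hy, hJ, hK⟩ := exists_short_family (X := X) Finset.univ ∅
    (Finset.disjoint_empty_left _) (by simp [linearIndepOn_empty])
  have hb : basesBetween X ∅ Finset.univ = bases X := by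
    ext B
    simp [basesBetween]
  have hspan : Submodule.span ℝ (X '' ↑(∅ ∪ Finset.univ : Finset ι)) = ⊤ := by simpa using hX
  have hGP : shortSpan X ∅ Finset.univ y ≤ P X := by
    refine Submodule.span_le.2 ?_
    rintro _ ⟨B, hB, rfl⟩
    exact Submodule.subset_span ⟨y B, short_of_disjoint hB.1 (hy B hB).2, rfl⟩
  have hPK : P X ≤ facetKer X ∅ Finset.univ := by
    refine Submodule.span_le.2 ?_
    rintro _ ⟨Y, hY, rfl⟩
    obtain ⟨B, hB, hYB⟩ := exists_basis_of_short hY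
    exact prodForm_mem_facetKer hB (by simp) (Finset.subset_univ Y) hYB
  have hKG : facetKer X ∅ Finset.univ ≤ shortSpan X ∅ Finset.univ y := by
    intro f hf
    obtain ⟨g, hg, h⟩ := hK hspan f hf
    rwa [sub_eq_zero.1 (orthIdeal_empty h)]
  have hP : P X = shortSpan X ∅ Finset.univ y := le_antisymm (hPK.trans hKG) hGP
  have hfin : (basesBetween X ∅ Finset.univ).Finite := Set.toFinite _
  refine ⟨?_, ?_, ?_, ?_⟩
  · rw [← facetKer_univ]
    exact le_antisymm hPK (hKG.trans hGP)
  · rw [eq_top_iff]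
    intro f _
    obtain ⟨g, hg, j, hj, h⟩ := hJ f
    rw [sub_eq_zero.1 (orthIdeal_empty h)]
    refine Submodule.add_mem_sup (hGP hg) ?_
    refine (Ideal.span_mono (Set.image_mono ?_) : longIdeal X ∅ Finset.univ ≤ J X) hj
    rintro Y ⟨-, hY⟩
    rwa [hb] at hY
  · rw [hP]
    exact FiniteDimensional.span_of_finite ℂ (hfin.image _)
  · rw [hP, ← hb]
    let G := hfin.toFinset.image fun B => prodForm X (y B)
    have h1 : shortSpan X ∅ Finset.univ y = Submodule.span ℂ (G : Set (Poly n)) := by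
      simp [shortSpan, G]
    rw [h1]
    refine (finrank_span_finset_le_card G).trans (Finset.card_image_le.trans ?_)
    rw [Set.ncard_eq_toFinset_card _ hfin]

/-! ## Interpolation at the vertices -/

/-- Restriction of the polynomials in `F` to the points of `σ`. -/
noncomputable def evalMap (σ : Set (Fin n → ℂ)) (F : Submodule ℂ (Poly n)) : F →ₗ[ℂ] σ → ℂ :=
  LinearMap.pi fun v => (MvPolynomial.aeval (v : Fin n → ℂ)).toLinearMap ∘ₗ F.subtype

theorem evalMap_apply (σ : Set (Fin n → ℂ)) (F : Submodule ℂ (Poly n)) (p : F) (v : σ) :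
    evalMap σ F p v = MvPolynomial.eval (v : Fin n → ℂ) (p : Poly n) := rfl

/-- The shifted product `∏ (p_i - c_i)`. -/
noncomputable def shiftedForm (X : ι → Fin n → ℝ) (c : ι → ℝ) (Y : Finset ι) : Poly n :=
  ∏ i ∈ Y, (linForm (X i) - MvPolynomial.C (c i : ℂ))

theorem eval_shiftedForm (c : ι → ℝ) (Y : Finset ι) (t : Fin n → ℝ) :
    MvPolynomial.eval (toComplex t) (shiftedForm X c Y) =
      ∏ i ∈ Y, ((X i ⬝ᵥ t - c i : ℝ) : ℂ) := by
  simp [shiftedForm, map_prod, eval_linForm]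

theorem shiftedForm_eq_sum [DecidableEq ι] (c : ι → ℝ) (Y : Finset ι) :
    shiftedForm X c Y =
      ∑ T ∈ Y.powerset, (∏ i ∈ Y \ T, (-(c i : ℂ))) • prodForm X T := by
  simp only [shiftedForm, sub_eq_add_neg]
  rw [Finset.prod_add]
  refine Finset.sum_congr rfl fun T _ => ?_
  rw [MvPolynomial.smul_eq_C_mul, map_prod, mul_comm, prodForm]
  simp

/-- Subsets of a short set are short, so every term of the expanded product lies in `P X`. -/
theorem shiftedForm_mem_P (c : ι → ℝ) {B Y : Finset ι} (hB : B ∈ bases X) (h : Disjoint Y B) :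
    shiftedForm X c Y ∈ P X := by
  classical
  rw [shiftedForm_eq_sum]
  refine sum_mem fun T hT => Submodule.smul_mem _ _ (Submodule.subset_span ⟨T, ?_, rfl⟩)
  exact short_of_disjoint hB (h.mono_left (Finset.mem_powerset.1 hT))

theorem Generic.ncard_vertices {lam : ι → ℝ} (h : Generic X lam) :
    (complexify (vertices X lam)).ncard = (bases X).ncard := by
  obtain ⟨v, hv, hV⟩ := h.exists_vertex
  have hinj : Set.InjOn v (bases X) := by
    intro B hB B' hB' hBB'
    ext i
    rw [← hv B hB, ← hv B' hB', hBB']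
  have hc : Function.Injective (toComplex (n := n)) := fun s t hst =>
    funext fun k => Complex.ofReal_injective (congrFun hst k)
  rw [complexify_eq, Set.ncard_image_of_injective _ hc, hV, hinj.ncard_image]

theorem Generic.finite_vertices [Finite ι] {lam : ι → ℝ} (h : Generic X lam) :
    (complexify (vertices X lam)).Finite := by
  obtain ⟨v, -, hV⟩ := h.exists_vertex
  rw [complexify_eq, hV]
  exact ((Set.toFinite _).image _).image _

/-- The Lagrange polynomials of the vertex set. -/
theorem Generic.exists_lagrange [Fintype ι] {lam : ι → ℝ} (h : Generic X lam)
    (v : complexify (vertices X lam)) : ∃ p ∈ P X, MvPolynomial.eval (v : Fin n → ℂ) p ≠ 0 ∧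
      ∀ w : complexify (vertices X lam), w ≠ v → MvPolynomial.eval (w : Fin n → ℂ) p = 0 := by
  classical
  obtain ⟨u, hu, hV⟩ := h.exists_vertex
  obtain ⟨_, t, ht, rfl⟩ := v
  rw [hV] at ht
  obtain ⟨B, hB, rfl⟩ := ht
  -- No hyperplane outside `B` passes through the vertex of `B`, whereas any other basis has an
  -- element outside `B`, whose factor vanishes at its vertex.
  refine ⟨shiftedForm X lam Bᶜ, shiftedForm_mem_P lam hB disjoint_compl_left, ?_, ?_⟩
  · change MvPolynomial.eval (toComplex (u B)) _ ≠ 0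
    rw [eval_shiftedForm, Finset.prod_ne_zero_iff]
    intro i hi
    rw [Complex.ofReal_ne_zero, sub_ne_zero, Ne, hu B hB]
    exact Finset.mem_compl.1 hi
  · rintro ⟨_, t, ht, rfl⟩ hw
    rw [hV] at ht
    obtain ⟨B', hB', rfl⟩ := ht
    change MvPolynomial.eval (toComplex (u B')) _ = 0
    rw [eval_shiftedForm, Finset.prod_eq_zero_iff]
    have hBB' : ¬ B' ⊆ B := by
      intro hsub
      refine hw (Subtype.ext (congrArg toComplex ?_))
      rw [Finset.eq_of_subset_of_card_le hsub (by rw [card_of_mem_bases hB, card_of_mem_bases hB'])]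
    obtain ⟨i, hi, hiB⟩ := Finset.not_subset.1 hBB'
    refine ⟨i, Finset.mem_compl.2 hiB, ?_⟩
    rw [(hu B' hB' i).2 hi, sub_self, Complex.ofReal_zero]

theorem Generic.evalMap_P_surjective [Fintype ι] {lam : ι → ℝ} (h : Generic X lam) :
    Function.Surjective (evalMap (complexify (vertices X lam)) (P X)) := by
  classical
  have := h.finite_vertices.to_subtype
  have := Fintype.ofFinite (complexify (vertices X lam))
  choose p hp hpv hpw using h.exists_lagrange
  intro c
  refine ⟨∑ v, (c v / MvPolynomial.eval (v : Fin n → ℂ) (p v)) • ⟨p v, hp v⟩, funext fun w => ?_⟩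
  rw [map_sum, Finset.sum_apply, Finset.sum_eq_single w]
  · rw [map_smul, Pi.smul_apply, evalMap_apply, smul_eq_mul, div_mul_cancel₀ _ (hpv w)]
  · intro v _ hvw
    rw [map_smul, Pi.smul_apply, evalMap_apply, hpw v w hvw.symm, smul_zero]
  · exact fun hw => (hw (Finset.mem_univ w)).elim

theorem finrank_fun_vertices [Finite ι] {lam : ι → ℝ} (h : Generic X lam) :
    Module.finrank ℂ (complexify (vertices X lam) → ℂ) = (bases X).ncard := by
  have := h.finite_vertices.to_subtype
  have := Fintype.ofFinite (complexify (vertices X lam))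
  rw [Module.finrank_fintype_fun_eq_card, ← Nat.card_eq_fintype_card, Nat.card_coe_set_eq,
    h.ncard_vertices]

/-! ## The least space -/

theorem coeff_least (f : Series n) (a : Fin n →₀ ℕ) :
    MvPolynomial.coeff a (least f) =
      if a.degree = f.order.toNat then MvPowerSeries.coeff a f else 0 := by
  rw [← MvPolynomial.coeff_coe, coe_least, MvPowerSeries.coeff_homogeneousComponent]

theorem least_eq_zero_iff {f : Series n} : least f = 0 ↔ f = 0 := by
  constructor
  · intro h
    by_contra hf
    obtain ⟨a, ha, hdeg⟩ := MvPowerSeries.exists_coeff_ne_zero_and_order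
      (MvPowerSeries.ne_zero_iff_order_finite.1 hf)
    have := coeff_least f a
    rw [h, MvPolynomial.coeff_zero, ← hdeg, ENat.toNat_natCast, if_pos rfl] at this
    exact ha this.symm
  · rintro rfl
    ext a
    simp [coeff_least]

theorem degree_of_mem_support {p : Poly n} {d : ℕ} (hp : p.IsHomogeneous d) {a : Fin n →₀ ℕ}
    (ha : a ∈ p.support) : a.degree = d := by
  rw [Finsupp.degree_eq_weight_one]
  exact hp (MvPolynomial.mem_support_iff.1 ha)

theorem pairing_eq_zero_of_isHomogeneous {p : Poly n} {d : ℕ} (hp : p.IsHomogeneous d)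
    {f : Series n} (hd : d < f.order) : pairing p f = 0 := by
  rw [pairing_eq_sum]
  refine Finset.sum_eq_zero fun a ha => ?_
  rw [MvPowerSeries.coeff_of_lt_order (by rwa [degree_of_mem_support hp ha]), mul_zero]

theorem pairing_least {p : Poly n} {d : ℕ} (hp : p.IsHomogeneous d) (f : Series n) :
    pairing p (toSeries (least f)) = if d = f.order.toNat then pairing p f else 0 := by
  have key : pairing p (toSeries (least f)) = ∑ a ∈ p.support, MvPolynomial.coeff a p *
      multiFactorial a * if d = f.order.toNat then MvPowerSeries.coeff a f else 0 := by
    rw [pairing_eq_sum]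
    refine Finset.sum_congr rfl fun a ha => ?_
    rw [coeff_toSeries, coeff_least, degree_of_mem_support hp ha]
  rw [key]
  split_ifs
  · rw [pairing_eq_sum]
  · simp

theorem isHomogeneous_prodForm (Y : Finset ι) : (prodForm X Y).IsHomogeneous Y.card := by
  have h : ∀ i ∈ Y, (linForm (X i)).IsHomogeneous 1 := fun i _ =>
    MvPolynomial.IsHomogeneous.sum _ _ _ fun k _ => by
      simpa using (MvPolynomial.isHomogeneous_C (Fin n) (X i k : ℂ)).mul
        (MvPolynomial.isHomogeneous_X ℂ k)
  simpa [prodForm] using MvPolynomial.IsHomogeneous.prod Y _ _ h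

/-- The shifted product differs from `p_Y` by terms of lower degree, which pair to zero with a
series of this order. -/
theorem pairing_mul_shiftedForm {q : Poly n} {d : ℕ} (hq : q.IsHomogeneous d) (c : ι → ℝ)
    (Y : Finset ι) {f : Series n} (hd : (d + Y.card : ℕ) ≤ f.order) :
    pairing (q * shiftedForm X c Y) f = pairing (q * prodForm X Y) f := by
  classical
  rw [shiftedForm_eq_sum, Finset.mul_sum, map_sum, LinearMap.sum_apply,
    Finset.sum_eq_single_of_mem Y (Finset.mem_powerset_self Y)]
  · simp
  · intro T hT hTY
    rw [mul_smul_comm, map_smul, LinearMap.smul_apply,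
      pairing_eq_zero_of_isHomogeneous (hq.mul (isHomogeneous_prodForm T)), smul_zero]
    refine lt_of_lt_of_le ?_ hd
    have := Finset.card_lt_card ((Finset.mem_powerset.1 hT).ssubset_of_ne hTY)
    exact_mod_cast Nat.add_lt_add_left this d

theorem pairing_eq_zero_of_mem_Exp {σ : Set (Fin n → ℂ)} {f : Series n} (hf : f ∈ Exp σ)
    {p : Poly n} (hp : ∀ v ∈ σ, MvPolynomial.eval v p = 0) : pairing p f = 0 := by
  induction hf using Submodule.span_induction with
  | mem g hg =>
    obtain ⟨v, hv, rfl⟩ := hg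
    rw [pairing_expSeries, hp v hv]
  | zero => simp
  | add g h _ _ hg hh => rw [map_add, hg, hh, add_zero]
  | smul a g _ hg => rw [map_smul, hg, smul_zero]

/-- For long `Y` the shifted product vanishes at every vertex, so its multiples annihilate `Exp`. On
the least term of `f` only the leading part `q * p_Y` is felt, and it pairs as the shifted product
does with `f`. -/
theorem Generic.leastSpace_le_D {lam : ι → ℝ} (h : Generic X lam) :
    leastSpace (complexify (vertices X lam)) ≤ D X := by
  obtain ⟨v, hv, hV⟩ := h.exists_vertex
  refine Submodule.span_le.2 ?_
  rintro _ ⟨f, hf, rfl⟩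
  simp only [D, SetLike.mem_coe, Submodule.mem_iInf, LinearMap.mem_ker]
  intro Y hY
  refine toSeries_injective ?_
  rw [map_zero]
  refine eq_zero_of_pairing_eq_zero fun q => ?_
  rw [← pairing_mul_toSeries]
  induction q using MvPolynomial.induction_on' with
  | add q₁ q₂ h₁ h₂ => rw [add_mul, map_add, LinearMap.add_apply, h₁, h₂, add_zero]
  | monomial a c =>
    have hq : (MvPolynomial.monomial a c).IsHomogeneous a.degree :=
      MvPolynomial.isHomogeneous_monomial c rfl
    rw [pairing_least (hq.mul (isHomogeneous_prodForm Y)), ite_eq_right_iff]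
    intro hd
    -- The zero series has order `⊤`, which `toNat` sends to `0`, so `hd` gives its order only for
    -- nonzero `f`.
    by_cases hf0 : f = 0
    · rw [hf0, map_zero]
    rw [← pairing_mul_shiftedForm hq lam Y
      (by rw [hd, MvPowerSeries.ne_zero_iff_order_finite.1 hf0])]
    refine pairing_eq_zero_of_mem_Exp hf fun w hw => ?_
    rw [complexify_eq, hV] at hw
    obtain ⟨_, ⟨B, hB, rfl⟩, rfl⟩ := hw
    obtain ⟨i, hiY, hiB⟩ := hY B hB
    rw [map_mul, eval_shiftedForm, Finset.prod_eq_zero hiY, mul_zero]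
    rw [(hv B hB i).2 hiB, sub_self, Complex.ofReal_zero]

/-! ### Interpolation from the least space, by positivity. -/

theorem coeff_expSeries_toComplex (t : Fin n → ℝ) (a : Fin n →₀ ℕ) :
    star (MvPowerSeries.coeff a (expSeries (toComplex t))) =
      MvPowerSeries.coeff a (expSeries (toComplex t)) := by
  change star (∏ i, (t i : ℂ) ^ a i / (Nat.factorial (a i) : ℂ)) =
    ∏ i, (t i : ℂ) ^ a i / (Nat.factorial (a i) : ℂ)
  simp

/-- As `g` is the conjugate of `f`, the pairing is the sum of `a! |f_a|²` over the support of `least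
g`, so it vanishes only if `least g` does. -/
theorem eq_zero_of_pairing_least_conj {f g : Series n}
    (hfg : ∀ a, MvPowerSeries.coeff a g = star (MvPowerSeries.coeff a f))
    (h : pairing (least g) f = 0) : g = 0 := by
  rw [← least_eq_zero_iff]
  rw [pairing_eq_sum] at h
  have hterm : ∀ a ∈ (least g).support, MvPolynomial.coeff a (least g) * multiFactorial a *
      MvPowerSeries.coeff a f =
        ((multiFactorial a * ‖MvPowerSeries.coeff a f‖ ^ 2 : ℝ) : ℂ) := by
    intro a ha
    have hne := MvPolynomial.mem_support_iff.1 ha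
    rw [coeff_least] at hne ⊢
    have hdeg : a.degree = g.order.toNat := by
      by_contra hdeg
      exact hne (if_neg hdeg)
    rw [if_pos hdeg, hfg, mul_right_comm]
    have := RCLike.conj_mul (MvPowerSeries.coeff a f)
    rw [Complex.star_def, this]
    push_cast
    exact mul_comm _ _
  rw [Finset.sum_congr rfl hterm, ← Complex.ofReal_sum, Complex.ofReal_eq_zero,
    Finset.sum_eq_zero_iff_of_nonneg fun a _ => by positivity] at h
  ext a
  rw [MvPolynomial.coeff_zero]
  by_contra hne
  have h1 := h a (MvPolynomial.mem_support_iff.2 hne)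
  have h2 : (multiFactorial a : ℝ) ≠ 0 := by exact_mod_cast multiFactorial_ne_zero a
  rw [mul_eq_zero, or_iff_right h2, sq_eq_zero_iff, norm_eq_zero] at h1
  rw [coeff_least, hfg, h1, star_zero, ite_self] at hne
  exact hne rfl

/-- A functional killing the image has the form `p ↦ ∑ c_v p(v) = ⟨p, f⟩` with `f = ∑ c_v e_v`. The
vertices are real, so the conjugate `g` of `f` again lies in `Exp`. Testing against `least g` forces
`f = 0`. -/
theorem Generic.evalMap_leastSpace_surjective [Fintype ι] {lam : ι → ℝ} (h : Generic X lam) :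
    Function.Surjective (evalMap (complexify (vertices X lam))
      (leastSpace (complexify (vertices X lam)))) := by
  classical
  have := h.finite_vertices.to_subtype
  have := Fintype.ofFinite (complexify (vertices X lam))
  by_contra hsurj
  rw [← LinearMap.range_eq_top] at hsurj
  obtain ⟨φ, hφ, hker⟩ := Submodule.exists_le_ker_of_lt_top _ (lt_top_iff_ne_top.2 hsurj)
  let c := fun v : complexify (vertices X lam) => φ (Pi.single v 1)
  have hφc : ∀ z, φ z = ∑ v, c v * z v := fun z => by
    conv_lhs => rw [← Finset.univ_sum_single z, map_sum]
    refine Finset.sum_congr rfl fun v _ => ?_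
    have : Pi.single v (z v) = z v • (Pi.single v 1 : complexify (vertices X lam) → ℂ) := by
      rw [← Pi.single_smul', smul_eq_mul, mul_one]
    rw [this, map_smul, smul_eq_mul, mul_comm]
  let f : Series n := ∑ v, c v • expSeries (v : Fin n → ℂ)
  let g : Series n := ∑ v, star (c v) • expSeries (v : Fin n → ℂ)
  have hpf : ∀ p : Poly n, pairing p f = ∑ v, c v * MvPolynomial.eval (v : Fin n → ℂ) p :=
    fun p => by simp [f, pairing_expSeries]
  have hg : g ∈ Exp (complexify (vertices X lam)) :=
    sum_mem fun v _ => Submodule.smul_mem _ _ (Submodule.subset_span ⟨v, v.2, rfl⟩)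
  have hfg : ∀ a, MvPowerSeries.coeff a g = star (MvPowerSeries.coeff a f) := fun a => by
    simp only [f, g, map_sum, map_smul, smul_eq_mul, star_sum, star_mul']
    refine Finset.sum_congr rfl fun v _ => ?_
    obtain ⟨_, t, ht, rfl⟩ := v
    congr 1
    exact (coeff_expSeries_toComplex t a).symm
  have hlg : least g ∈ leastSpace (complexify (vertices X lam)) :=
    Submodule.subset_span ⟨g, hg, rfl⟩
  have h0 : pairing (least g) f = 0 := by
    rw [hpf]
    have : evalMap (complexify (vertices X lam)) _ ⟨least g, hlg⟩ ∈ LinearMap.ker φ :=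
      hker (LinearMap.mem_range_self _ _)
    rw [LinearMap.mem_ker, hφc] at this
    exact this
  have hg0 := eq_zero_of_pairing_least_conj hfg h0
  have hf0 : f = 0 := by
    ext a
    have := hfg a
    rw [hg0, map_zero, eq_comm, star_eq_zero] at this
    rw [this, map_zero]
  refine hφ (LinearMap.ext fun z => ?_)
  -- That `f = 0` forces the functional to vanish needs polynomials with arbitrary vertex values; `P
  -- X` supplies them.
  obtain ⟨p, rfl⟩ := h.evalMap_P_surjective z
  have := hpf p
  rw [hf0, map_zero] at this
  rw [hφc, LinearMap.zero_apply, this]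
  rfl

/-! ## Duality -/

theorem dualityMap_apply (F G : Submodule ℂ (Poly n)) (p : F) (q : G) :
    dualityMap F G p q = pairing (p : Poly n) (toSeries (q : Poly n)) := rfl

/-- A polynomial of `𝒟(X)` orthogonal to `𝒫(X)` is zero, as `𝒫(X) + 𝒥(X)` is everything. -/
theorem dualityMap_injective (h : P X ⊔ (J X).restrictScalars ℂ = ⊤) :
    Function.Injective (dualityMap (D X) (P X)) := by
  rw [← LinearMap.ker_eq_bot, LinearMap.ker_eq_bot']
  intro p hp
  refine Subtype.ext (toSeries_injective ?_)
  rw [Submodule.coe_zero, map_zero]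
  refine eq_zero_of_pairing_eq_zero fun q => ?_
  obtain ⟨a, ha, b, hb, rfl⟩ := Submodule.mem_sup.1 (h ▸ Submodule.mem_top :
    q ∈ P X ⊔ (J X).restrictScalars ℂ)
  have hpD := mem_polyKer_iff_pairing.1 (D_eq_polyKer.le p.2)
  rw [map_add, LinearMap.add_apply, hpD b hb, add_zero, pairing_comm]
  exact LinearMap.congr_fun hp ⟨a, ha⟩

/-- Every functional on `P X` is pairing with an element of `D X`, and all of these kill `J X`. -/
theorem disjoint_P_J (h : Function.Surjective (dualityMap (D X) (P X))) :
    Disjoint (P X) ((J X).restrictScalars ℂ) := by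
  rw [Submodule.disjoint_def]
  intro q hqP hqJ
  have h0 : (⟨q, hqP⟩ : P X) = 0 := by
    refine (Module.forall_dual_apply_eq_zero_iff ℂ _).1 fun φ => ?_
    obtain ⟨p, rfl⟩ := h φ
    rw [dualityMap_apply, pairing_comm]
    exact mem_polyKer_iff_pairing.1 (D_eq_polyKer.le p.2) q hqJ
  exact congrArg Subtype.val h0

end Zonotopal

theorem mainTheorem11 {n : ℕ} {ι : Type*} [Fintype ι] (X : ι → Fin n → ℝ)
    (hX0 : ∀ i, X i ≠ 0) (hXspan : Submodule.span ℝ (Set.range X) = ⊤) :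
    -- (1) dimensions
    (Module.Finite ℂ (Zonotopal.P X) ∧ Module.Finite ℂ (Zonotopal.D X) ∧
      Module.finrank ℂ (Zonotopal.P X) = (Zonotopal.bases X).ncard ∧
      Module.finrank ℂ (Zonotopal.D X) = (Zonotopal.bases X).ncard) ∧
    -- (2) duality
    Function.Bijective (Zonotopal.dualityMap (Zonotopal.D X) (Zonotopal.P X)) ∧
    -- (3) `D(X)` as a least space and as a kernel
    ((∀ lam : ι → ℝ, Zonotopal.Generic X lam →
        Zonotopal.D X =
          Zonotopal.leastSpace (Zonotopal.complexify (Zonotopal.vertices X lam))) ∧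
      (Zonotopal.D X).map Zonotopal.toSeries = Zonotopal.ker (Zonotopal.J X) ∧
      Zonotopal.D X = Zonotopal.polyKer (Zonotopal.J X)) ∧
    -- (4) correctness of the vertex set
    (∀ lam : ι → ℝ, Zonotopal.Generic X lam →
      Zonotopal.Correct (Zonotopal.complexify (Zonotopal.vertices X lam)) (Zonotopal.D X) ∧
      Zonotopal.Correct (Zonotopal.complexify (Zonotopal.vertices X lam)) (Zonotopal.P X)) ∧
    -- (5) `P(X)` as a kernel
    ((Zonotopal.P X).map Zonotopal.toSeries = Zonotopal.ker (Zonotopal.I X) ∧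
      Zonotopal.P X = Zonotopal.polyKer (Zonotopal.I X)) ∧
    -- (6) direct sum decomposition
    IsCompl (Zonotopal.P X) ((Zonotopal.J X).restrictScalars ℂ) := by
  classical
  open Zonotopal in
  obtain ⟨hPI, hPJ, hPfin, hPle⟩ := P_structure hXspan
  obtain ⟨B, hB, -⟩ : ∃ B ∈ bases X, B ⊆ Finset.univ :=
    exists_basis_subset (by simpa using hXspan)
  have hP : ∀ lam, Generic X lam → Module.finrank ℂ (P X) = (bases X).ncard := fun lam hlam =>
    le_antisymm hPle (finrank_fun_vertices hlam ▸
      LinearMap.finrank_le_finrank_of_surjective hlam.evalMap_P_surjective)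
  have hinj := dualityMap_injective hPJ
  have hDfin : Module.Finite ℂ (D X) := Module.Finite.of_injective _ hinj
  have hDle : Module.finrank ℂ (D X) ≤ Module.finrank ℂ (P X) :=
    (LinearMap.finrank_le_finrank_of_injective hinj).trans_eq Subspace.dual_finrank_eq
  have hL : ∀ lam, Generic X lam → Module.Finite ℂ (leastSpace (complexify (vertices X lam))) ∧
      (bases X).ncard ≤ Module.finrank ℂ (leastSpace (complexify (vertices X lam))) := by
    intro lam hlam
    have := Submodule.finiteDimensional_of_le hlam.leastSpace_le_D
    exact ⟨this, finrank_fun_vertices hlam ▸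
      LinearMap.finrank_le_finrank_of_surjective hlam.evalMap_leastSpace_surjective⟩
  have hDL : ∀ lam, Generic X lam → D X = leastSpace (complexify (vertices X lam)) := by
    intro lam hlam
    refine (Submodule.eq_of_le_of_finrank_le hlam.leastSpace_le_D ?_).symm
    exact (hDle.trans (hP lam hlam).le).trans (hL lam hlam).2
  -- The dimension and duality statements do not involve `λ`, but their lower bounds come from one
  -- generic arrangement.
  obtain ⟨lam₀, hlam₀⟩ := exists_generic X
  have hP₀ := hP lam₀ hlam₀
  have hD₀ : Module.finrank ℂ (D X) = (bases X).ncard :=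
    le_antisymm (hDle.trans hP₀.le) (hDL lam₀ hlam₀ ▸ (hL lam₀ hlam₀).2)
  have hbij : Function.Bijective (dualityMap (D X) (P X)) := ⟨hinj,
    (LinearMap.injective_iff_surjective_of_finrank_eq_finrank
      (by rw [hD₀, Subspace.dual_finrank_eq, hP₀])).1 hinj⟩
  have hcorrect : ∀ lam, Generic X lam → ∀ F : Submodule ℂ (Poly n), Module.Finite ℂ F →
      Module.finrank ℂ F = (bases X).ncard →
      Function.Surjective (evalMap (complexify (vertices X lam)) F) →
      Correct (complexify (vertices X lam)) F := by
    intro lam hlam F _ hF hsurj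
    have := hlam.finite_vertices.to_subtype
    exact ⟨(LinearMap.injective_iff_surjective_of_finrank_eq_finrank
      (hF.trans (finrank_fun_vertices hlam).symm)).2 hsurj, hsurj⟩
  refine ⟨⟨hPfin, hDfin, hP₀, hD₀⟩, hbij, ⟨hDL, ?_, D_eq_polyKer⟩, fun lam hlam => ⟨?_, ?_⟩,
    ⟨?_, hPI⟩, disjoint_P_J hbij.2, codisjoint_iff.2 hPJ⟩
  · rw [D_eq_polyKer, map_toSeries_polyKer (zeroLocus_J hB)]
  · exact hcorrect lam hlam _ hDfin hD₀ (hDL lam hlam ▸ hlam.evalMap_leastSpace_surjective)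
  · exact hcorrect lam hlam _ hPfin hP₀ hlam.evalMap_P_surjective
  · rw [hPI, map_toSeries_polyKer (zeroLocus_I hB)]
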